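/- Setting. Let $N\ge 0$ and $p\ge 1$ be integers. Let $f(\lambda,z)\in\mathbb{C}^N$ be complex entire in $(\lambda,z)\in\mathbb{C}\times\mathbb{C}^N$ and real for real arguments. Let $g(\lambda,\varepsilon,\beta,z)\in\mathbb{C}^N$ be continuous, of period $1$ in the real variable $\beta$, complex entire in $(\lambda,\varepsilon,z)$ for each $\beta$, and real for real arguments. Let $\gamma:\mathbb{R}\to\mathbb{R}^N$ be a nonstationary periodic solution, of minimal period $1$, of $\dot x=f(0,x)$, and put $A(\sigma)=\partial_zf(0,\gamma(\sigma))$. Assume: (H1) $\gamma$ is hyperbolic: the trivial Floquet multiplier $1$ is algebraically simple, i.e. $1$ is a simple root of the characteristic polynomial of $\Phi(1)$, where $\dot\Phi=A\Phi$, $\Phi(0)=\mathrm{id}$. (H2) $\partial_\lambda f(0,\gamma(\cdot))$ is not in the range of $\mathcal{L}\zeta=\dot\zeta-A\zeta$ from $C^1(\mathbb{R}/\mathbb{Z},\mathbb{C}^N)$ to $C^0(\mathbb{R}/\mathbb{Z},\mathbb{C}^N)$; equivalently, it spans the one-dimensional cokernel of $\mathcal{L}$. For $\varepsilon=1/n$,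 consider the rapidly forced equation $$\dot z(\sigma)=f(\lambda,z(\sigma))+\varepsilon^p\,g(\lambda,\varepsilon,\sigma/\varepsilon,z(\sigma)).\qquad(*)$$ For $\delta>0$ and $\alpha\in\mathbb{R}$, a $\delta$-local solution at $(\varepsilon,\alpha)$ is a pair $(\lambda,z)$ of a real number $\lambda$ with $|\lambda|<\delta$ and a real $1$-periodic solution $z$ of $(*)$ such that $|z(\sigma)-\gamma(\sigma+\alpha)|<\delta$ for all real $\sigma$, where $|\cdot|$ is the maximum norm, and $\int_0^1 (z(\sigma)-\gamma(\sigma+\alpha))^T\dot\gamma(\sigma+\alpha)\,d\sigma=0$. Theorem. There are $\delta>0$ and real functions $\alpha\mapsto\lambda(1/n,\alpha)$ on $\mathbb{R}$ ($n\in\mathbb{N}$) such that, for all sufficiently large $n$ and $\varepsilon=1/n$, there is for every $\alpha\in\mathbb{R}$ exactly one $\delta$-local solution at $(\varepsilon,\alpha)$, and its parameter is $\lambda(\varepsilon,\alpha)$; the function $\lambda(\varepsilon,\cdot)$ is continuous and has period $\varepsilon$. Moreover $\lambda(1/n,\alpha)\to0$ as $n\to\infty$, uniformly in $\alpha\in\mathbb{R}$.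 Let $I(\varepsilon)=\lambda(\varepsilon,\mathbb{R})$ be the resonance plateau, and let $\ell(\varepsilon)$ be the length of this interval. Then: (i) For every $\eta>0$ such that $\gamma$ extends analytically to a neighborhood of the closed strip $|\operatorname{Im}t|\le\eta$, there is a constant $C_\eta$ such that $$\ell(\varepsilon)\le C_\eta\exp(-\eta/\varepsilon)\qquad\text{for all sufficiently small }\varepsilon=1/n>0.$$ (ii) If $\gamma$ extends to a complex entire function, then for every $\eta>0$ there is a constant $C_\eta$ such that the estimate in (i) holds for all sufficiently small $\varepsilon=1/n>0$; that is, the plateaus are ultra-exponentially thin. -/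

import Mathlib

/-- The inclusion of real vectors into complex vectors. -/
def toComplexVec {N : ℕ} (x : Fin N → ℝ) : Fin N → ℂ := fun i => (x i : ℂ)

/-- A complex vector all of whose entries are real. -/
def IsRealVec {N : ℕ} (v : Fin N → ℂ) : Prop := ∀ i, (v i).im = 0

/-- The family of vector fields `f(μ, z)` is complex entire, jointly in `(μ, z) ∈ ℂ × ℂ^N`,
and real for real arguments. -/
def IsRealEntireField {N : ℕ} (f : ℂ → (Fin N → ℂ) → Fin N → ℂ) : Prop :=
  Differentiable ℂ (fun x : ℂ × (Fin N → ℂ) => f x.1 x.2) ∧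
    ∀ (μ : ℝ) (x : Fin N → ℝ), IsRealVec (f μ (toComplexVec x))

/-- The forcing term `g(μ, ε, β, z)`: jointly continuous, of period 1 in the real variable `β`,
complex entire in `(μ, ε, z)` for each `β`, and real for real arguments. -/
def IsRealEntireForcing {N : ℕ} (g : ℂ → ℂ → ℝ → (Fin N → ℂ) → Fin N → ℂ) : Prop :=
  Continuous (fun x : ℂ × ℂ × ℝ × (Fin N → ℂ) => g x.1 x.2.1 x.2.2.1 x.2.2.2) ∧
    (∀ β, Differentiable ℂ (fun x : ℂ × ℂ × (Fin N → ℂ) => g x.1 x.2.1 β x.2.2)) ∧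
    (∀ μ ε β z, g μ ε (β + 1) z = g μ ε β z) ∧
    ∀ (μ ε β : ℝ) (x : Fin N → ℝ), IsRealVec (g μ ε β (toComplexVec x))

/-- `γ` is a real, nonstationary solution of minimal period 1 of `γ' = f(0, γ)`. -/
def IsPeriodicOrbit {N : ℕ} (f : ℂ → (Fin N → ℂ) → Fin N → ℂ) (γ : ℝ → Fin N → ℝ) : Prop :=
  (∀ σ, HasDerivAt (fun s => toComplexVec (γ s)) (f 0 (toComplexVec (γ σ))) σ) ∧
    Function.Periodic γ 1 ∧ ∀ T, 0 < T → T < 1 → ¬ Function.Periodic γ T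

/-- The Floquet linearization `A(σ) = ∂_z f(0, γ(σ))`. -/
noncomputable def floquetLinearization {N : ℕ} (f : ℂ → (Fin N → ℂ) → Fin N → ℂ)
    (γ : ℝ → Fin N → ℝ) (σ : ℝ) : (Fin N → ℂ) →L[ℂ] (Fin N → ℂ) :=
  fderiv ℂ (f 0) (toComplexVec (γ σ))

/-- `γ` is hyperbolic: the trivial Floquet multiplier 1 is algebraically simple, that is, 1 is a
simple root of the characteristic polynomial of the monodromy `Φ(1)`, where `Φ` is the
fundamental solution of `Φ' = A(σ) Φ`, `Φ(0) = id`. -/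
def IsHyperbolicOrbit {N : ℕ} (f : ℂ → (Fin N → ℂ) → Fin N → ℂ) (γ : ℝ → Fin N → ℝ) : Prop :=
  ∃ Φ : ℝ → (Fin N → ℂ) →L[ℂ] (Fin N → ℂ),
    Φ 0 = ContinuousLinearMap.id ℂ (Fin N → ℂ) ∧
    (∀ σ, HasDerivAt Φ ((floquetLinearization f γ σ).comp (Φ σ)) σ) ∧
    (LinearMap.charpoly (Φ 1 : (Fin N → ℂ) →ₗ[ℂ] (Fin N → ℂ))).rootMultiplicity 1 = 1

/-- `∂_μ f(0, γ(·))` is not in the range of the operator `ζ ↦ ζ' - A ζ` from the 1-periodic `C¹`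
functions to the 1-periodic continuous functions. For hyperbolic `γ` this operator is Fredholm
of index zero with one-dimensional kernel, so that this says that `∂_μ f(0, γ(·))` spans its
one-dimensional cokernel. -/
def IsParameterTransverse {N : ℕ} (f : ℂ → (Fin N → ℂ) → Fin N → ℂ)
    (γ : ℝ → Fin N → ℝ) : Prop :=
  ¬ ∃ ζ : ℝ → Fin N → ℂ, Function.Periodic ζ 1 ∧ ∀ σ,
    HasDerivAt ζ (floquetLinearization f γ σ (ζ σ)
      + deriv (fun μ : ℂ => f μ (toComplexVec (γ σ))) 0) σ

/-- `z` is a real 1-periodic solution of the rapidly forced equation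
`z' = f(μ, z) + ε^p g(μ, ε, σ/ε, z)`, at the real parameter `μ`. -/
def IsForcedPeriodicSolution {N : ℕ} (f : ℂ → (Fin N → ℂ) → Fin N → ℂ)
    (g : ℂ → ℂ → ℝ → (Fin N → ℂ) → Fin N → ℂ) (p : ℕ) (ε μ : ℝ) (z : ℝ → Fin N → ℝ) : Prop :=
  Function.Periodic z 1 ∧ ∀ σ,
    HasDerivAt (fun s => toComplexVec (z s))
      (f μ (toComplexVec (z σ)) + (ε : ℂ) ^ p • g μ ε (σ / ε) (toComplexVec (z σ))) σ

/-- `(μ, z)` is a solution of the forced periodic problem for the phase shift `α`, with `μ` and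
the deviation `ζ = z - γ(· + α)` smaller than `δ`, and with `ζ` in the distributed Poincaré section
`∫₀¹ ζ(σ)ᵀ γ'(σ + α) dσ = 0`. -/
def IsLocalSolution {N : ℕ} (f : ℂ → (Fin N → ℂ) → Fin N → ℂ)
    (g : ℂ → ℂ → ℝ → (Fin N → ℂ) → Fin N → ℂ) (p : ℕ) (γ : ℝ → Fin N → ℝ)
    (δ ε α μ : ℝ) (z : ℝ → Fin N → ℝ) : Prop :=
  |μ| < δ ∧ (∀ σ, ‖z σ - γ (σ + α)‖ < δ) ∧
    IsForcedPeriodicSolution f g p ε μ z ∧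
    ∫ σ in (0 : ℝ)..1, ∑ i, (z σ i - γ (σ + α) i) * deriv γ (σ + α) i = 0

/-- `γ` extends analytically to a neighborhood of the closed strip `|Im t| ≤ η`. -/
def IsStripAnalytic {N : ℕ} (γ : ℝ → Fin N → ℝ) (η : ℝ) : Prop :=
  ∃ Γ : ℂ → Fin N → ℂ, AnalyticOnNhd ℂ Γ {t : ℂ | |t.im| ≤ η} ∧
    ∀ σ : ℝ, Γ σ = toComplexVec (γ σ)

/-- `γ` extends to a complex entire function. -/
def IsComplexEntire {N : ℕ} (γ : ℝ → Fin N → ℝ) : Prop :=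
  ∃ Γ : ℂ → Fin N → ℂ, Differentiable ℂ Γ ∧ ∀ σ : ℝ, Γ σ = toComplexVec (γ σ)

/-- The resonance plateau `I = lam(ℝ)` of a function `lam` of the phase shift. -/
def resonancePlateau (lam : ℝ → ℝ) : Set ℝ := Set.range lam

/-- The width `ℓ` of the resonance plateau: its length, for continuous periodic `lam`. -/
noncomputable def plateauWidth (lam : ℝ → ℝ) : ℝ := Metric.diam (resonancePlateau lam)

section

set_option maxSynthPendingDepth 3

open Set Metric Filter Topology unitInterval

/-! ### Holomorphic maps into spaces of continuous functions -/

section Holomorphic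

variable {W : Type*} [NormedAddCommGroup W] [NormedSpace ℂ W]

/-! Write z = γ(· + α) + ζ. In integral form, the equation for (λ, ζ) with periodicity and phase
condition becomes a fixed point problem u = S(α)⁻¹(0, ∫₀ᵗ N(α, u)). Here S(α) is the linearized
boundary value problem along γ(α + t), `shiftedOp`, and N consists of the Taylor remainder of f and
the forcing. The forcing is O(1/n), so a uniform contraction yields a locally unique solution u(α) =
O(1/n) (`exists_branch`).

The decisive point is that α enters only through the curve γ(α + t), while the fast time t/ε stays
real. Hence α may be made complex although g is merely continuous in β. The phase condition is
written with f(0, γ) = γ' and the bilinear product, so it is holomorphic in α as well. The iterates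
of the contraction are then holomorphic in α and converge uniformly, so λ(ε, ·) is holomorphic and
bounded on a strip whose width does not depend on ε.

Invertibility of S(α) at real α follows from hyperbolicity, transversality and the phase condition
(`shiftedOp_zero_injective`). For complex α, S(α) is a finite-rank perturbation of an invertible
Volterra operator, so it suffices that a scalar determinant `boundaryDet`, holomorphic in α, is
nonzero. Translating time by s carries the kernel at α + s to the kernel at α, so the zero set of
the determinant is invariant under real shifts. One zero would produce a line of zeros, and the
determinant would vanish identically (`isUnit_shiftedOp_of_strip`).

Shifting time by ε leaves the forcing unchanged and replaces α by α + ε. By uniqueness λ(ε, ·) has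
period ε, on the strip too by the identity theorem. The k-th Fourier coefficient of an ε-periodic
bounded holomorphic function is O(exp(-2π|k|h/ε)) if the contour can be moved by h. Since 2π/4 > 1,
the choice h = η/4 already gives exp(-η/ε) (`norm_sub_le_exp_of_periodic_strip`). For entire γ every
η is admissible. -/

lemma ContinuousMap.circleIntegral_apply {K : Type*} [TopologicalSpace K] [CompactSpace K]
    [CompleteSpace W] {φ : ℂ → C(K, W)} {c : ℂ} {R : ℝ} (hφ : CircleIntegrable φ c R) (k : K) :
    (∮ z in C(c, R), φ z) k = ∮ z in C(c, R), φ z k := by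
  have h := (ContinuousMap.evalCLM ℂ k : C(K, W) →L[ℂ] W).intervalIntegral_comp_comm
    (μ := MeasureTheory.volume) hφ.out
  simp only [circleIntegral]
  simpa using h.symm

/-- A continuous map into `C(K, W)` that is pointwise holomorphic is holomorphic. -/
theorem differentiableOn_continuousMap {K : Type*} [TopologicalSpace K] [CompactSpace K]
    [CompleteSpace W] {φ : ℂ → C(K, W)} {U : Set ℂ} (hU : IsOpen U) (hφ : ContinuousOn φ U)
    (hk : ∀ k, DifferentiableOn ℂ (fun z => φ z k) U) : DifferentiableOn ℂ φ U := by
  intro c hc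
  obtain ⟨R, hR, hRU⟩ := nhds_basis_closedBall.mem_iff.1 (hU.mem_nhds hc)
  lift R to NNReal using hR.le
  have hR' : 0 < R := by exact_mod_cast hR
  have hci : CircleIntegrable φ c R :=
    (hφ.mono (sphere_subset_closedBall.trans hRU)).circleIntegrable hR.le
  -- The Cauchy integral of a continuous function is holomorphic with values in `C(K, W)`. It equals
  -- φ because evaluation at each k commutes with the integral and the scalar-parameter Cauchy
  -- formula holds pointwise.
  have h := (hasFPowerSeriesOn_cauchy_integral hci hR').differentiableOn
  refine ((h.congr fun w hw => ?_).differentiableAt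
    (eball_mem_nhds c (by exact_mod_cast hR'))).differentiableWithinAt
  rw [Metric.eball_coe] at hw
  have hint : CircleIntegrable (fun z => (z - w)⁻¹ • φ z) c R := by
    refine ContinuousOn.circleIntegrable hR.le (ContinuousOn.smul (ContinuousOn.inv₀
      (f := fun z => z - w) (by fun_prop) fun z hz h0 => ?_) (hφ.mono (sphere_subset_closedBall.trans hRU)))
    rw [mem_ball] at hw; rw [mem_sphere] at hz
    rw [sub_eq_zero.1 h0] at hz; linarith
  ext k
  have := (hk k).mono hRU |>.circleIntegral_sub_inv_smul hw
  rw [ContinuousMap.smul_apply, ContinuousMap.circleIntegral_apply hint]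
  simp only [ContinuousMap.smul_apply, this]
  rw [inv_smul_smul₀]
  simp [Real.pi_ne_zero]

/-- Integration over `[0, t]`, as an operator on the continuous functions on `[0, 1]`. -/
noncomputable def primitiveCLM (W : Type*) [NormedAddCommGroup W] [NormedSpace ℂ W] :
    C(I, W) →L[ℂ] C(I, W) :=
  LinearMap.mkContinuous
    { toFun := fun h => ⟨fun t => ∫ s in (0 : ℝ)..t, IccExtend zero_le_one h s,
        (intervalIntegral.continuous_primitive
          (fun a b => (h.continuous.Icc_extend').intervalIntegrable a b) 0).comp
          continuous_subtype_val⟩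
      map_add' := fun h k => by
        ext t
        exact intervalIntegral.integral_add ((h.continuous.Icc_extend').intervalIntegrable _ _)
          ((k.continuous.Icc_extend').intervalIntegrable _ _)
      map_smul' := fun c h => by
        ext t
        exact intervalIntegral.integral_smul c _ } 1 (by
    intro h
    rw [one_mul, ContinuousMap.norm_le _ (norm_nonneg _)]
    intro t
    refine (intervalIntegral.norm_integral_le_of_norm_le_const (C := ‖h‖)
      fun s _ => h.norm_coe_le_norm _).trans ?_
    have h1 := t.2.1
    have h2 := t.2.2
    rw [sub_zero, abs_of_nonneg h1]
    nlinarith [norm_nonneg h])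

lemma primitiveCLM_apply (h : C(I, W)) (t : I) :
    primitiveCLM W h t = ∫ s in (0 : ℝ)..t, IccExtend zero_le_one h s := rfl

lemma norm_primitiveCLM_le : ‖primitiveCLM W‖ ≤ 1 :=
  LinearMap.mkContinuous_norm_le _ zero_le_one _

lemma norm_primitiveCLM_apply_le (h : C(I, W)) : ‖primitiveCLM W h‖ ≤ ‖h‖ := by
  simpa using (primitiveCLM W).le_of_opNorm_le norm_primitiveCLM_le h

lemma primitiveCLM_eq_integral {h : C(I, W)} {k : ℝ → W} (hk : ∀ s : I, h s = k s) (t : I) :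
    primitiveCLM W h t = ∫ s in (0 : ℝ)..t, k s := by
  refine intervalIntegral.integral_congr fun s hs => ?_
  rw [uIcc_of_le t.2.1] at hs
  have hs' : s ∈ I := ⟨hs.1, hs.2.trans t.2.2⟩
  rw [IccExtend_of_mem _ _ hs', hk]

variable {E : Type*} [NormedAddCommGroup E] [NormedSpace ℂ E]

/-- The derivative of a holomorphic map on a finite-dimensional space is continuous. -/
theorem continuous_fderiv_of_holomorphic [FiniteDimensional ℂ E] {F : E → W}
    (hF : Differentiable ℂ F) : Continuous (fderiv ℂ F) := by
  have : ProperSpace E := FiniteDimensional.proper ℂ E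
  refine Metric.continuous_iff.2 fun x₀ κ hκ => ?_
  have huc := (isCompact_closedBall x₀ (2 : ℝ)).uniformContinuousOn_of_continuous
    hF.continuous.continuousOn
  obtain ⟨d, hd, hdF⟩ := Metric.uniformContinuousOn_iff.1 huc (κ / 4) (by positivity)
  refine ⟨min d 1, by positivity, fun x hx => ?_⟩
  have hx1 : dist x x₀ < 1 := hx.trans_le (min_le_right _ _)
  have hxd : dist x x₀ < d := hx.trans_le (min_le_left _ _)
  -- The difference of the derivatives at x and x₀ is the derivative of h at x₀. Uniform continuity
  -- makes h small on a unit ball, and the Cauchy estimate makes its derivative small.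
  set h : E → W := fun y => F (y + (x - x₀)) - F y with hh
  have hdh : Differentiable ℂ h := (hF.comp (by fun_prop)).sub hF
  have hb : ∀ y ∈ ball x₀ 1, ‖h y‖ ≤ κ / 4 := by
    intro y hy
    rw [hh, ← dist_eq_norm]
    rw [mem_ball] at hy
    refine (hdF _ ?_ _ ?_ ?_).le
    · rw [mem_closedBall]
      calc dist (y + (x - x₀)) x₀ ≤ dist (y + (x - x₀)) y + dist y x₀ := dist_triangle _ _ _
        _ ≤ 1 + 1 := by
          gcongr
          rw [dist_eq_norm, add_sub_cancel_left, ← dist_eq_norm]; exact hx1.le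
        _ = 2 := by norm_num
    · rw [mem_closedBall]; linarith
    · rw [dist_eq_norm, add_sub_cancel_left, ← dist_eq_norm]; exact hxd
  have key := Complex.norm_fderiv_le_div_of_mapsTo_ball (c := x₀) (R₁ := 1) (R₂ := κ / 2)
    hdh.differentiableOn (fun y hy => by
      rw [mem_closedBall, dist_eq_norm]
      linarith [norm_sub_le (h y) (h x₀), hb y hy, hb x₀ (mem_ball_self one_pos)]) one_pos
  have e1 : fderiv ℂ h x₀ = fderiv ℂ F x - fderiv ℂ F x₀ := by
    have h1 : DifferentiableAt ℂ (fun y => F (y + (x - x₀))) x₀ :=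
      (hF _).comp _ (by fun_prop)
    rw [hh, fderiv_fun_sub h1 (hF _), fderiv_comp_add_right]
    simp
  rw [e1] at key
  rw [dist_eq_norm]
  linarith

/-- Along a holomorphic curve, the derivative of a holomorphic map is holomorphic. -/
theorem differentiableOn_fderiv_comp [FiniteDimensional ℂ E] [CompleteSpace W]
    {F : E → W} (hF : Differentiable ℂ F) {x : ℂ → E} {U : Set ℂ} (hU : IsOpen U)
    (hx : DifferentiableOn ℂ x U) : DifferentiableOn ℂ (fun z => fderiv ℂ F (x z)) U := by
  suffices h : ∀ v, DifferentiableOn ℂ (fun z => fderiv ℂ F (x z) v) U by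
    have := contDiffOn_clm_apply (𝕜 := ℂ) (n := 1) (f := fun z => fderiv ℂ F (x z)) (s := U) |>.2
      fun v => (h v).contDiffOn hU
    exact this.differentiableOn one_ne_zero
  intro v
  -- Cauchy kernel of the first derivative at 0 on the unit circle, parametrized by θ = 2πt; this
  -- explains the extra factor 2π. The directional derivative becomes a fixed continuous linear
  -- functional of the path t ↦ c(t) F(x(z) + e^{iθ} v), which is holomorphic in z.
  let c : ℝ → ℂ := fun t => (2 * Real.pi * Complex.I)⁻¹ * (2 * Real.pi) *
    (deriv (circleMap 0 1) (2 * Real.pi * t) * ((circleMap 0 1 (2 * Real.pi * t)) ^ 2)⁻¹)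
  have hcont : Continuous c := by
    refine continuous_const.mul (Continuous.mul ?_ (Continuous.inv₀ (by fun_prop) ?_))
    · simp only [deriv_circleMap]; fun_prop
    · intro t; simp [circleMap]
  let φ : ℂ → C(I, W) := fun z =>
    ⟨fun t => c t • F (x z + circleMap 0 1 (2 * Real.pi * t) • v), by
      have := hF.continuous; fun_prop⟩
  have hφ : DifferentiableOn ℂ φ U := by
    refine differentiableOn_continuousMap hU ?_ fun t => ?_
    · rw [continuousOn_iff_continuous_domRestrict]
      refine ContinuousMap.continuous_of_continuous_uncurry _ ?_
      have h1 := continuousOn_iff_continuous_domRestrict.1 hx.continuousOn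
      have : Continuous fun p : U × I =>
          c p.2 • F (U.domRestrict x p.1 + circleMap 0 1 (2 * Real.pi * p.2) • v) := by
        have := hF.continuous
        fun_prop
      exact this
    · exact (hF.comp_differentiableOn (hx.add_const _)).const_smul (c t)
  have hd := ((ContinuousMap.evalCLM ℂ (1 : I)).comp (primitiveCLM W)).differentiable
    |>.comp_differentiableOn hφ
  refine hd.congr fun z hz => ?_
  set G : ℂ → W := fun w => F (x z + w • v) with hG
  have hGd : Differentiable ℂ G := hF.comp (by fun_prop)
  have h1 := Complex.two_pi_I_inv_smul_circleIntegral_sub_sq_inv_smul_of_differentiable isOpen_univ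
    (subset_univ _) hGd.differentiableOn (mem_ball_self (one_pos (α := ℝ)) : (0 : ℂ) ∈ ball 0 1)
  have h2 : deriv G 0 = fderiv ℂ F (x z) v := by
    have h3 : HasDerivAt G (fderiv ℂ F (x z + (0 : ℂ) • v) ((1 : ℂ) • v)) 0 :=
      (hF (x z + (0 : ℂ) • v)).hasFDerivAt.comp_hasDerivAt (0 : ℂ)
        (((hasDerivAt_id (0 : ℂ)).smul_const v).const_add (x z))
    simpa using h3.deriv
  rw [← h2, ← h1]
  change _ = (primitiveCLM W (φ z)) 1
  rw [primitiveCLM_eq_integral (k := fun t : ℝ => c t • G (circleMap 0 1 (2 * Real.pi * t)))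
    (fun s => rfl)]
  simp only [circleIntegral, sub_zero, c, mul_smul, intervalIntegral.integral_smul]
  congr 1
  have h3 := intervalIntegral.smul_integral_comp_mul_left (a := 0) (b := 1)
    (fun θ => deriv (circleMap 0 1) θ • ((circleMap 0 1 θ) ^ 2)⁻¹ • G (circleMap 0 1 θ))
    (2 * Real.pi)
  simp only [mul_zero, mul_one] at h3
  rw [← h3]
  simp [← Complex.coe_smul, mul_smul]

/-- Bounds for a holomorphic map give Lipschitz bounds. -/
theorem norm_sub_le_of_holomorphic_of_bound {h : E → W} (hh : Differentiable ℂ h) {r K : ℝ}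
    (hr : 0 < r) (hK : ∀ x ∈ closedBall (0 : E) (2 * r), ‖h x‖ ≤ K) {x y : E}
    (hx : x ∈ closedBall (0 : E) r) (hy : y ∈ closedBall (0 : E) r) :
    ‖h x - h y‖ ≤ 2 * K / r * ‖x - y‖ := by
  let _ : NormedSpace ℝ E := NormedSpace.restrictScalars ℝ ℂ E
  refine (convex_closedBall (0 : E) r).norm_image_sub_le_of_norm_fderiv_le (𝕜 := ℂ)
    (fun z _ => hh z) (fun z hz => ?_) hy hx
  have hsub : ball z r ⊆ closedBall (0 : E) (2 * r) := fun w hw => by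
    rw [mem_closedBall] at hz ⊢
    rw [mem_ball] at hw
    linarith [dist_triangle w z 0]
  refine Complex.norm_fderiv_le_div_of_mapsTo_ball hh.differentiableOn (fun w hw => ?_) hr
  rw [mem_closedBall, dist_eq_norm]
  linarith [norm_sub_le (h w) (h z), hK w (hsub hw), hK z (hsub (mem_ball_self hr))]

end Holomorphic

/-! ### Finite-rank perturbations of invertible operators -/

section FiniteRank

variable {V W : Type*} [NormedAddCommGroup V] [NormedSpace ℂ V]
  [NormedAddCommGroup W] [NormedSpace ℂ W]

/-- The operator on the finite-dimensional space `W` which decides whether `D + ι π` is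
invertible. -/
noncomputable def reducedOp (D : V →L[ℂ] V) (ι : W →L[ℂ] V) (π : V →L[ℂ] W) : W →L[ℂ] W :=
  1 + π ∘L (Ring.inverse D) ∘L ι

lemma ring_inverse_apply {D : V →L[ℂ] V} (hD : IsUnit D) (v : V) : D (Ring.inverse D v) = v := by
  simpa using DFunLike.congr_fun (Ring.mul_inverse_cancel D hD) v

lemma ring_inverse_apply' {D : V →L[ℂ] V} (hD : IsUnit D) (v : V) : Ring.inverse D (D v) = v := by
  simpa using DFunLike.congr_fun (Ring.inverse_mul_cancel D hD) v

/-- The Woodbury formula: `D + ι π` is invertible if `1 + π D⁻¹ ι` is. -/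
theorem isUnit_add_comp_of_isUnit_reducedOp {D : V →L[ℂ] V} (hD : IsUnit D) (ι : W →L[ℂ] V)
    (π : V →L[ℂ] W) (hG : IsUnit (reducedOp D ι π)) : IsUnit (D + ι ∘L π) := by
  set G := reducedOp D ι π with hGdef
  have hGa : ∀ w, G w = w + π (Ring.inverse D (ι w)) := fun w => by simp [hGdef, reducedOp]
  -- The Woodbury inverse D⁻¹ - D⁻¹ ι (1 + π D⁻¹ ι)⁻¹ π D⁻¹.
  set Q : V →L[ℂ] V :=
    Ring.inverse D - Ring.inverse D ∘L ι ∘L Ring.inverse G ∘L π ∘L Ring.inverse D with hQ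
  have hQa : ∀ v, Q v = Ring.inverse D v -
    Ring.inverse D (ι (Ring.inverse G (π (Ring.inverse D v)))) := fun v => by simp [hQ]
  refine isUnit_iff_exists.2 ⟨Q, ?_, ?_⟩
  · ext v
    simp only [mul_apply_eq_comp, add_apply,
      ContinuousLinearMap.comp_apply, one_apply_eq_self, hQa, map_sub,
      ring_inverse_apply hD]
    set w := Ring.inverse G (π (Ring.inverse D v)) with hw
    have h1 : G w = π (Ring.inverse D v) := by rw [hw, ring_inverse_apply hG]
    rw [hGa] at h1
    rw [← h1]
    simp
  · ext v
    simp only [mul_apply_eq_comp, add_apply,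
      ContinuousLinearMap.comp_apply, one_apply_eq_self, hQa, map_add,
      ring_inverse_apply' hD]
    have h1 : Ring.inverse G (π v) + Ring.inverse G (π (Ring.inverse D (ι (π v)))) = π v := by
      rw [← map_add, ← hGa, ring_inverse_apply' hG]
    rw [← map_add (Ring.inverse D), ← map_add ι, h1]
    abel

/-- If w is in the kernel of 1 + π D⁻¹ ι, then v = D⁻¹ ι w satisfies (D + ι π) v = ι (w + π v) = 0.
Hence v = 0 and w = -π v = 0. -/
theorem reducedOp_injective {D : V →L[ℂ] V} (hD : IsUnit D) (ι : W →L[ℂ] V)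
    (π : V →L[ℂ] W) (h : ∀ v, (D + ι ∘L π) v = 0 → v = 0) (w : W)
    (hw : reducedOp D ι π w = 0) : w = 0 := by
  have hGa : w + π (Ring.inverse D (ι w)) = 0 := by simpa [reducedOp] using hw
  have h1 : Ring.inverse D (ι w) = 0 := by
    refine h _ ?_
    simp only [_root_.add_apply, ContinuousLinearMap.comp_apply,
      ring_inverse_apply hD]
    rw [← map_add, hGa, map_zero]
  simpa [h1] using hGa

theorem isUnit_of_det_ne_zero [FiniteDimensional ℂ W] {G : W →L[ℂ] W}
    (h : LinearMap.det (G : W →ₗ[ℂ] W) ≠ 0) : IsUnit G := by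
  have : CompleteSpace W := FiniteDimensional.complete ℂ W
  rw [ContinuousLinearMap.isUnit_iff_bijective]
  have h1 := (LinearMap.isUnit_iff_isUnit_det (G : W →ₗ[ℂ] W)).2 (isUnit_iff_ne_zero.2 h)
  exact (Module.End.isUnit_iff _).1 h1

theorem det_ne_zero_of_injective [FiniteDimensional ℂ W] {G : W →L[ℂ] W}
    (h : ∀ w, G w = 0 → w = 0) : LinearMap.det (G : W →ₗ[ℂ] W) ≠ 0 := by
  have h1 : IsUnit (G : W →ₗ[ℂ] W) :=
    (LinearMap.isUnit_iff_ker_eq_bot _).2 (LinearMap.ker_eq_bot'.2 h)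
  exact ((LinearMap.isUnit_iff_isUnit_det _).1 h1).ne_zero

theorem differentiableOn_det [FiniteDimensional ℂ W] {G : ℂ → W →L[ℂ] W} {U : Set ℂ}
    (hG : DifferentiableOn ℂ G U) :
    DifferentiableOn ℂ (fun z => LinearMap.det (G z : W →ₗ[ℂ] W)) U := by
  let b := Module.finBasis ℂ W
  have h : ∀ i j, DifferentiableOn ℂ
      (fun z => LinearMap.toMatrix b b (G z : W →ₗ[ℂ] W) i j) U := by
    intro i j
    have : DifferentiableOn ℂ (fun z => (b.coord i).toContinuousLinearMap (G z (b j))) U :=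
      (b.coord i).toContinuousLinearMap.differentiable.comp_differentiableOn
        (hG.clm_apply (differentiableOn_const _))
    simpa [LinearMap.toMatrix_apply] using this
  simp_rw [← LinearMap.det_toMatrix b, Matrix.det_apply]
  refine DifferentiableOn.fun_sum fun τ _ => ?_
  simp_rw [Units.smul_def, zsmul_eq_mul]
  exact (DifferentiableOn.fun_finsetProd fun i _ => h _ _).const_mul _

end FiniteRank

/-! ### The linear periodic boundary value problem with a parameter -/

section BoundaryValueProblem

/-- Pointwise application of a continuous family of operators. -/
noncomputable def applyCLM (K X W : Type*) [TopologicalSpace K] [CompactSpace K]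
    [NormedAddCommGroup X] [NormedSpace ℂ X] [NormedAddCommGroup W] [NormedSpace ℂ W] :
    C(K, X →L[ℂ] W) →L[ℂ] C(K, X) →L[ℂ] C(K, W) :=
  LinearMap.mkContinuous₂
    (LinearMap.mk₂ ℂ (fun (P : C(K, X →L[ℂ] W)) (u : C(K, X)) =>
        (⟨fun t => P t (u t), P.continuous.clm_apply u.continuous⟩ : C(K, W)))
      (fun _ _ _ => by ext; simp) (fun _ _ _ => by ext; simp) (fun _ _ _ => by ext; simp)
      (fun _ _ _ => by ext; simp)) 1 (by
    intro P u
    rw [one_mul, ContinuousMap.norm_le _ (by positivity)]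
    intro t
    exact (P t).le_of_opNorm_le_of_le (P.norm_coe_le_norm t) (u.norm_coe_le_norm t))

variable {E : Type*} [NormedAddCommGroup E] [NormedSpace ℂ E]

/-- A parameter and a path, as a path of pairs. -/
noncomputable def pairCLM (E : Type*) [NormedAddCommGroup E] [NormedSpace ℂ E] :
    (ℂ × C(I, E)) →L[ℂ] C(I, ℂ × E) :=
  LinearMap.mkContinuous
    { toFun := fun u => ⟨fun t => (u.1, u.2 t), by fun_prop⟩
      map_add' := fun u v => by ext <;> simp
      map_smul' := fun c u => by ext <;> simp } 1 (by
    intro u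
    rw [one_mul, ContinuousMap.norm_le _ (norm_nonneg _)]
    intro t
    exact max_le_max le_rfl (u.2.norm_coe_le_norm t))

omit [NormedSpace ℂ E] in
lemma norm_pair_le (u : ℂ × C(I, E)) (t : I) : ‖(u.1, u.2 t)‖ ≤ ‖u‖ :=
  max_le_max le_rfl (u.2.norm_coe_le_norm t)

omit [NormedSpace ℂ E] in
lemma norm_le_of_pair {u : ℂ × C(I, E)} {C : ℝ} (h : ∀ t : I, ‖(u.1, u.2 t)‖ ≤ C) : ‖u‖ ≤ C :=
  max_le ((le_max_left _ _).trans (h 0)) ((ContinuousMap.norm_le _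
    ((norm_nonneg _).trans (h 0))).2 fun t => (le_max_right _ _).trans (h t))

/-- The Volterra operator `(μ, ζ) ↦ (0, ∫₀ᵗ P(s) (μ, ζ(s)) ds)`. -/
noncomputable def volterraOp (P : C(I, (ℂ × E) →L[ℂ] E)) :
    (ℂ × C(I, E)) →L[ℂ] (ℂ × C(I, E)) :=
  ContinuousLinearMap.inr ℂ ℂ C(I, E) ∘L primitiveCLM E ∘L applyCLM I (ℂ × E) E P ∘L pairCLM E

lemma volterraOp_fst (P : C(I, (ℂ × E) →L[ℂ] E)) (u : ℂ × C(I, E)) : (volterraOp P u).1 = 0 :=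
  rfl

lemma volterraOp_snd (P : C(I, (ℂ × E) →L[ℂ] E)) (u : ℂ × C(I, E)) (t : I) :
    (volterraOp P u).2 t = ∫ s in (0 : ℝ)..t,
      IccExtend zero_le_one (fun s : I => P s (u.1, u.2 s)) s := rfl

/-- The usual Picard estimate: each application integrates the bound (‖P‖ s)^k / k! once more. The
parameter component is killed by the operator, so only the path has to be estimated. -/
lemma norm_volterraOp_pow_le (P : C(I, (ℂ × E) →L[ℂ] E)) (u : ℂ × C(I, E)) (k : ℕ) (t : I) :
    ‖(((volterraOp P ^ k) u).1, ((volterraOp P ^ k) u).2 t)‖ ≤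
      (‖P‖ * t) ^ k / k.factorial * ‖u‖ := by
  induction k generalizing t with
  | zero => simpa using norm_pair_le u t
  | succ k ih =>
    rw [pow_succ', mul_apply_eq_comp]
    set v := (volterraOp P ^ k) u
    rw [Prod.norm_mk, volterraOp_fst, norm_zero, max_eq_right (norm_nonneg _), volterraOp_snd]
    have h1 := intervalIntegral.norm_integral_le_of_norm_le (μ := MeasureTheory.volume) t.2.1
      (f := IccExtend zero_le_one (fun s : I => P s (v.1, v.2 s)))
      (g := fun s => ‖P‖ ^ (k + 1) / k.factorial * ‖u‖ * s ^ k) (by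
        refine Filter.Eventually.of_forall fun s hs => ?_
        have hs' : s ∈ I := ⟨hs.1.le, hs.2.trans t.2.2⟩
        rw [IccExtend_of_mem _ _ hs']
        refine ((P ⟨s, hs'⟩).le_of_opNorm_le_of_le (P.norm_coe_le_norm _) (ih ⟨s, hs'⟩)).trans
          (le_of_eq ?_)
        simp only []
        ring) (Continuous.intervalIntegrable (by fun_prop) _ _)
    refine h1.trans (le_of_eq ?_)
    rw [intervalIntegral.integral_const_mul, integral_pow, Nat.factorial_succ]
    push_cast
    field_simp
    ring

/-- Some power V^k has norm below 1, so 1 - V^k is invertible. It is the product of the commuting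
factors 1 - V and Σ V^i, hence both factors are invertible. No smallness of P is needed. -/
theorem isUnit_one_sub_volterraOp [CompleteSpace E] (P : C(I, (ℂ × E) →L[ℂ] E)) :
    IsUnit (1 - volterraOp P) := by
  obtain ⟨k, hk⟩ := ((FloorSemiring.tendsto_pow_div_factorial_atTop ‖P‖).eventually
    (gt_mem_nhds (zero_lt_one (α := ℝ)))).exists
  have h1 : ‖volterraOp P ^ k‖ < 1 := by
    refine lt_of_le_of_lt (ContinuousLinearMap.opNorm_le_bound _ (by positivity)
      fun u => norm_le_of_pair fun t => ?_) hk
    refine (norm_volterraOp_pow_le P u k t).trans ?_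
    gcongr
    · exact mul_nonneg (norm_nonneg P) t.2.1
    · exact mul_le_of_le_one_right (norm_nonneg P) t.2.2
  have h2 := isUnit_one_sub_of_norm_lt_one (R := (ℂ × C(I, E)) →L[ℂ] (ℂ × C(I, E))) h1
  rw [← mul_neg_geom_sum] at h2
  refine ((Commute.isUnit_mul_iff ?_).1 h2).1
  exact (Commute.sum_right _ _ _ fun i _ =>
    ((Commute.one_left _).sub_left (Commute.refl _)).pow_right i)

/-- The phase condition `ζ ↦ ∫₀¹ e(s) ζ(s) ds`. -/
noncomputable def sectionCLM (e : C(I, E →L[ℂ] ℂ)) : C(I, E) →L[ℂ] ℂ :=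
  ContinuousMap.evalCLM ℂ (1 : I) ∘L primitiveCLM ℂ ∘L applyCLM I E ℂ e

/-- The boundary data `(∫ e ζ - μ, ζ(1))`. -/
noncomputable def boundaryData (e : C(I, E →L[ℂ] ℂ)) : (ℂ × C(I, E)) →L[ℂ] ℂ × E :=
  (sectionCLM e ∘L ContinuousLinearMap.snd ℂ ℂ C(I, E) - ContinuousLinearMap.fst ℂ ℂ C(I, E)).prod
    (ContinuousMap.evalCLM ℂ (1 : I) ∘L ContinuousLinearMap.snd ℂ ℂ C(I, E))

/-- The inclusion of constants, with a sign in the second component. -/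
noncomputable def constantLift (E : Type*) [NormedAddCommGroup E] [NormedSpace ℂ E] :
    ℂ × E →L[ℂ] (ℂ × C(I, E)) :=
  LinearMap.mkContinuous
    { toFun := fun w => (w.1, -ContinuousMap.const I w.2)
      map_add' := fun u v => by ext <;> simp [add_comm]
      map_smul' := fun c u => by ext <;> simp } 1 (fun w => by
    refine norm_le_of_pair fun t => ?_
    simp [Prod.norm_def])

/-- The operator of the periodic boundary value problem:
`(μ, ζ) ↦ (∫ e ζ, ζ - ζ(1) - ∫₀ᵗ P(s) (μ, ζ(s)) ds)`. -/
noncomputable def boundaryOp (P : C(I, (ℂ × E) →L[ℂ] E)) (e : C(I, E →L[ℂ] ℂ)) :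
    (ℂ × C(I, E)) →L[ℂ] (ℂ × C(I, E)) :=
  (1 - volterraOp P) + constantLift E ∘L boundaryData e

lemma boundaryOp_fst (P : C(I, (ℂ × E) →L[ℂ] E)) (e : C(I, E →L[ℂ] ℂ)) (u : ℂ × C(I, E)) :
    (boundaryOp P e u).1 = ∫ s in (0 : ℝ)..1, IccExtend zero_le_one (fun s : I => e s (u.2 s)) s := by
  have : (boundaryOp P e u).1 = u.1 - 0 + (sectionCLM e u.2 - u.1) := rfl
  rw [this, sub_zero, add_sub_cancel]
  rfl

lemma boundaryOp_snd (P : C(I, (ℂ × E) →L[ℂ] E)) (e : C(I, E →L[ℂ] ℂ)) (u : ℂ × C(I, E)) (t : I) :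
    (boundaryOp P e u).2 t = u.2 t - u.2 1 - ∫ s in (0 : ℝ)..t,
      IccExtend zero_le_one (fun s : I => P s (u.1, u.2 s)) s := by
  have : (boundaryOp P e u).2 t = u.2 t - (volterraOp P u).2 t + -(u.2 1) := rfl
  rw [this, volterraOp_snd]
  abel

/-- The characteristic determinant of the periodic boundary value problem. -/
noncomputable def boundaryDet (P : C(I, (ℂ × E) →L[ℂ] E)) (e : C(I, E →L[ℂ] ℂ)) : ℂ :=
  LinearMap.det (reducedOp (1 - volterraOp P) (constantLift E) (boundaryData e) :
    ℂ × E →ₗ[ℂ] ℂ × E)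

/-- Together with `boundaryDet_ne_zero`, this turns invertibility of an operator on an
infinite-dimensional space into nonvanishing of a scalar function, to which the identity theorem
applies. -/
theorem isUnit_boundaryOp_of_boundaryDet_ne_zero [FiniteDimensional ℂ E] [CompleteSpace E]
    {P : C(I, (ℂ × E) →L[ℂ] E)} {e : C(I, E →L[ℂ] ℂ)} (h : boundaryDet P e ≠ 0) :
    IsUnit (boundaryOp P e) :=
  isUnit_add_comp_of_isUnit_reducedOp (isUnit_one_sub_volterraOp P) _ _ (isUnit_of_det_ne_zero h)

theorem boundaryDet_ne_zero [FiniteDimensional ℂ E] [CompleteSpace E]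
    {P : C(I, (ℂ × E) →L[ℂ] E)} {e : C(I, E →L[ℂ] ℂ)}
    (h : ∀ u, boundaryOp P e u = 0 → u = 0) : boundaryDet P e ≠ 0 :=
  det_ne_zero_of_injective (reducedOp_injective (isUnit_one_sub_volterraOp P) _ _ h)

section Regularity

lemma _root_.ContinuousLinearMap.differentiableOn_apply {A B : Type*} [NormedAddCommGroup A]
    [NormedSpace ℂ A] [NormedAddCommGroup B] [NormedSpace ℂ B] (L : A →L[ℂ] B) {f : ℂ → A}
    {U : Set ℂ} (hf : DifferentiableOn ℂ f U) : DifferentiableOn ℂ (fun z => L (f z)) U :=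
  L.differentiable.comp_differentiableOn hf

variable {P : ℂ → C(I, (ℂ × E) →L[ℂ] E)} {e : ℂ → C(I, E →L[ℂ] ℂ)} {U : Set ℂ}

lemma differentiableOn_volterraOp (hP : DifferentiableOn ℂ P U) :
    DifferentiableOn ℂ (fun z => volterraOp (P z)) U := by
  unfold volterraOp
  have h1 : DifferentiableOn ℂ (fun z => applyCLM I (ℂ × E) E (P z)) U :=
    (applyCLM I (ℂ × E) E).differentiableOn_apply hP
  exact (differentiableOn_const _).clm_comp ((differentiableOn_const _).clm_comp
    (h1.clm_comp (differentiableOn_const _)))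

lemma differentiableOn_boundaryData (he : DifferentiableOn ℂ e U) :
    DifferentiableOn ℂ (fun z => boundaryData (e z)) U := by
  have h1 : DifferentiableOn ℂ (fun z => applyCLM I E ℂ (e z)) U :=
    (applyCLM I E ℂ).differentiableOn_apply he
  have h2 : DifferentiableOn ℂ (fun z => sectionCLM (e z) ∘L ContinuousLinearMap.snd ℂ ℂ C(I, E) -
      ContinuousLinearMap.fst ℂ ℂ C(I, E)) U :=
    (((differentiableOn_const _).clm_comp ((differentiableOn_const _).clm_comp h1)).clm_comp
      (differentiableOn_const _)).sub_const _
  have h3 : (fun z => boundaryData (e z)) = fun z =>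
      ContinuousLinearMap.inl ℂ ℂ E ∘L (sectionCLM (e z) ∘L ContinuousLinearMap.snd ℂ ℂ C(I, E) -
        ContinuousLinearMap.fst ℂ ℂ C(I, E)) + ContinuousLinearMap.inr ℂ ℂ E ∘L
        (ContinuousMap.evalCLM ℂ (1 : I) ∘L ContinuousLinearMap.snd ℂ ℂ C(I, E)) := by
    funext z
    apply ContinuousLinearMap.ext
    intro u
    ext <;> simp [boundaryData]
  rw [h3]
  exact ((differentiableOn_const _).clm_comp h2).add_const _

lemma differentiableOn_boundaryOp (hP : DifferentiableOn ℂ P U) (he : DifferentiableOn ℂ e U) :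
    DifferentiableOn ℂ (fun z => boundaryOp (P z) (e z)) U :=
  ((differentiableOn_volterraOp hP).const_sub 1).fun_add
    ((differentiableOn_const (constantLift E)).clm_comp (differentiableOn_boundaryData he))

/-- The Volterra part 1 - V is invertible for every coefficient path, so its inverse, and with it
the determinant, has no singularities in the parameter. -/
lemma differentiableOn_boundaryDet [FiniteDimensional ℂ E] [CompleteSpace E]
    (hP : DifferentiableOn ℂ P U) (he : DifferentiableOn ℂ e U) :
    DifferentiableOn ℂ (fun z => boundaryDet (P z) (e z)) U := by
  refine differentiableOn_det (G := fun z =>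
    reducedOp (1 - volterraOp (P z)) (constantLift E) (boundaryData (e z))) ?_
  have h0 : DifferentiableOn ℂ
      (fun z => (1 : (ℂ × C(I, E)) →L[ℂ] (ℂ × C(I, E))) - volterraOp (P z)) U :=
    (differentiableOn_volterraOp hP).const_sub _
  have h1 : DifferentiableOn ℂ (fun z => Ring.inverse (1 - volterraOp (P z))) U :=
    h0.inverse fun z _ => isUnit_one_sub_volterraOp (P z)
  exact ((differentiableOn_boundaryData he).clm_comp
    (h1.clm_comp (differentiableOn_const _))).const_add _

lemma continuous_boundaryOp (hP : Continuous P) (he : Continuous e) :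
    Continuous (fun z => boundaryOp (P z) (e z)) := by
  have h3 : ∀ z, boundaryData (e z) =
      ContinuousLinearMap.inl ℂ ℂ E ∘L (sectionCLM (e z) ∘L ContinuousLinearMap.snd ℂ ℂ C(I, E) -
        ContinuousLinearMap.fst ℂ ℂ C(I, E)) + ContinuousLinearMap.inr ℂ ℂ E ∘L
        (ContinuousMap.evalCLM ℂ (1 : I) ∘L ContinuousLinearMap.snd ℂ ℂ C(I, E)) := by
    intro z
    apply ContinuousLinearMap.ext
    intro u
    ext <;> simp [boundaryData]
  have h1 := (applyCLM I (ℂ × E) E).continuous.comp hP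
  have h2 := (applyCLM I E ℂ).continuous.comp he
  simp only [boundaryOp, h3, volterraOp, sectionCLM]
  simp only [Function.comp_def] at h1 h2
  fun_prop

end Regularity

end BoundaryValueProblem

/-! ### Uniform contractions -/

/-- A family of uniform contractions has a family of fixed points, which is the uniform limit of
the iterates from zero. -/
theorem exists_fixedPoint_of_uniform_contraction {A Y : Type*} [NormedAddCommGroup Y]
    [CompleteSpace Y] (T : A → Y → Y) {m r : ℝ} (hm : ∀ a, ‖T a 0‖ ≤ m) (hmr : 2 * m ≤ r)
    (hT : ∀ a, ∀ x ∈ closedBall (0 : Y) r, ∀ y ∈ closedBall (0 : Y) r,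
      ‖T a x - T a y‖ ≤ 1 / 2 * ‖x - y‖) :
    ∃ u : A → Y, (∀ a, ‖u a‖ ≤ 2 * m) ∧ (∀ a, T a (u a) = u a) ∧
      (∀ a x, ‖x‖ ≤ r → T a x = x → x = u a) ∧
      (∀ k a, ‖(T a)^[k] 0‖ ≤ r) ∧ TendstoUniformly (fun k a => (T a)^[k] 0) u atTop := by
  -- The increments are at most m/2^k and the iterates at most the partial geometric sum, so they
  -- stay in the ball of radius 2m ≤ r where T contracts. Both bounds must be proved together. The
  -- form `2 * m / 2 / 2 ^ k` is that of the geometric Cauchy criterion with constant 2m.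
  have key : ∀ a k, ‖(T a)^[k] 0‖ ≤ 2 * m - 2 * m / 2 ^ k ∧
      ‖(T a)^[k] 0 - (T a)^[k + 1] 0‖ ≤ 2 * m / 2 / 2 ^ k := by
    intro a k
    have hm0 : 0 ≤ m := (norm_nonneg _).trans (hm a)
    induction k with
    | zero => simpa using hm a
    | succ k ih =>
      have h1 : ‖(T a)^[k + 1] 0‖ ≤ 2 * m - 2 * m / 2 ^ (k + 1) := by
        have h2 := norm_sub_norm_le ((T a)^[k + 1] 0) ((T a)^[k] 0)
        rw [norm_sub_rev] at h2
        have h3 : 2 * m / 2 ^ (k + 1) = 2 * m / 2 / 2 ^ k := by rw [pow_succ]; ring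
        have h4 : 2 * m / 2 ^ k = 2 * (2 * m / 2 / 2 ^ k) := by ring
        linarith [ih.1, ih.2]
      have hb : ∀ j, 2 * m - 2 * m / 2 ^ j ≤ r := fun j => by
        have : 0 ≤ 2 * m / 2 ^ j := by positivity
        linarith
      refine ⟨h1, ?_⟩
      have h5 := hT a _ (mem_closedBall_zero_iff.2 (ih.1.trans (hb _))) _
        (mem_closedBall_zero_iff.2 (h1.trans (hb _)))
      simp only [← Function.iterate_succ_apply' (T a)] at h5
      refine h5.trans ?_
      have h3 : 2 * m / 2 / 2 ^ (k + 1) = 1 / 2 * (2 * m / 2 / 2 ^ k) := by rw [pow_succ]; ring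
      rw [h3]
      linarith [ih.2]
  have hlim : ∀ a, ∃ x, Tendsto (fun k => (T a)^[k] 0) atTop (𝓝 x) := fun a =>
    cauchySeq_tendsto_of_complete (cauchySeq_of_le_geometric_two (C := 2 * m) fun k => by
      rw [dist_eq_norm]; exact (key a k).2)
  choose u hu using hlim
  have hdist : ∀ a k, dist ((T a)^[k] 0) (u a) ≤ 2 * m / 2 ^ k := fun a k =>
    dist_le_of_le_geometric_two_of_tendsto (fun k => by rw [dist_eq_norm]; exact (key a k).2)
      (hu a) k
  have hu2 : ∀ a, ‖u a‖ ≤ 2 * m := fun a => by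
    simpa [dist_eq_norm] using hdist a 0
  have hkr : ∀ k a, ‖(T a)^[k] 0‖ ≤ r := fun k a => by
    have hm0 : 0 ≤ m := (norm_nonneg _).trans (hm a)
    have : 0 ≤ 2 * m / 2 ^ k := by positivity
    linarith [(key a k).1]
  have hfix : ∀ a, T a (u a) = u a := by
    intro a
    refine tendsto_nhds_unique (f := fun k => (T a)^[k + 1] 0) (l := atTop) ?_
      ((hu a).comp (tendsto_add_atTop_nat 1))
    rw [tendsto_iff_norm_sub_tendsto_zero]
    refine squeeze_zero (fun _ => norm_nonneg _) (fun k => ?_)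
      (by simpa using (tendsto_iff_norm_sub_tendsto_zero.1 (hu a)).const_mul (1 / 2))
    rw [Function.iterate_succ_apply']
    exact hT a _ (mem_closedBall_zero_iff.2 (hkr k a)) _
      (mem_closedBall_zero_iff.2 ((hu2 a).trans hmr))
  refine ⟨u, hu2, hfix, fun a x hx hxT => ?_, hkr, ?_⟩
  · have h1 := hT a x (mem_closedBall_zero_iff.2 hx) (u a)
      (mem_closedBall_zero_iff.2 ((hu2 a).trans hmr))
    rw [hxT, hfix] at h1
    have : ‖x - u a‖ = 0 := le_antisymm (by linarith) (norm_nonneg _)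
    exact sub_eq_zero.1 (norm_eq_zero.1 this)
  · rw [Metric.tendstoUniformly_iff]
    intro κ hκ
    have : Tendsto (fun k : ℕ => 2 * m / 2 ^ k) atTop (𝓝 0) :=
      tendsto_const_nhds.div_atTop (tendsto_pow_atTop_atTop_of_one_lt one_lt_two)
    filter_upwards [this.eventually (gt_mem_nhds hκ)] with k hk a
    rw [dist_comm]
    exact (hdist a k).trans_lt hk

/-- The linearization error of a holomorphic map has small Lipschitz constant on small balls,
uniformly for bounded base points. -/
theorem exists_linearization_error_lipschitz {V W : Type*} [NormedAddCommGroup V] [NormedSpace ℂ V]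
    [FiniteDimensional ℂ V] [NormedAddCommGroup W] [NormedSpace ℂ W] {F : V → W}
    (hF : Differentiable ℂ F) (R : ℝ) {κ : ℝ} (hκ : 0 < κ) :
    ∃ r, 0 < r ∧ r ≤ 1 ∧ ∀ x₀, ‖x₀‖ ≤ R → ∀ x ∈ closedBall (0 : V) r, ∀ y ∈ closedBall (0 : V) r,
      ‖(F (x₀ + x) - fderiv ℂ F x₀ x) - (F (x₀ + y) - fderiv ℂ F x₀ y)‖ ≤ κ * ‖x - y‖ := by
  have : ProperSpace V := FiniteDimensional.proper ℂ V
  let _ : NormedSpace ℝ V := NormedSpace.restrictScalars ℝ ℂ V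
  have huc := (isCompact_closedBall (0 : V) (R + 1)).uniformContinuousOn_of_continuous
    (continuous_fderiv_of_holomorphic hF).continuousOn
  obtain ⟨d, hd, hdF⟩ := Metric.uniformContinuousOn_iff.1 huc κ hκ
  refine ⟨min (d / 2) 1, by positivity, min_le_right _ _, fun x₀ hx₀ x hx y hy => ?_⟩
  -- The linearization error has derivative DF(x₀ + z) - DF(x₀), which is small by uniform
  -- continuity of DF on the ball of radius R + 1. The mean value inequality then gives the
  -- Lipschitz constant.
  have hder : ∀ z, HasFDerivAt (fun z => F (x₀ + z) - fderiv ℂ F x₀ z)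
      (fderiv ℂ F (x₀ + z) - fderiv ℂ F x₀) z := fun z => by
    have h1 : HasFDerivAt (fun z => F (x₀ + z)) (fderiv ℂ F (x₀ + z)) z := by
      have := (hF (x₀ + z)).hasFDerivAt.comp z ((hasFDerivAt_id z).const_add x₀)
      exact this
    exact h1.sub (fderiv ℂ F x₀).hasFDerivAt
  refine (convex_closedBall (0 : V) (min (d / 2) 1)).norm_image_sub_le_of_norm_hasFDerivWithin_le
    (𝕜 := ℂ) (fun z _ => (hder z).hasFDerivWithinAt) (fun z hz => ?_) hy hx
  rw [mem_closedBall_zero_iff] at hz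
  rw [← dist_eq_norm]
  refine (hdF _ ?_ _ ?_ ?_).le
  · rw [mem_closedBall_zero_iff]
    linarith [norm_add_le x₀ z, min_le_right (d / 2) 1]
  · rw [mem_closedBall_zero_iff]; linarith
  · rw [dist_eq_norm, add_sub_cancel_left]
    linarith [min_le_left (d / 2) 1]

/-! ### The nonlinear boundary value problem along a complex shift of a curve -/

section ShiftedProblem

variable {E : Type*} [NormedAddCommGroup E] [NormedSpace ℂ E]

/-- The segment `t ↦ x(α + t)`, `0 ≤ t ≤ 1`, of a continuous curve. -/
noncomputable def curveSegment {W : Type*} [TopologicalSpace W] (x : C(ℂ, W)) (α : ℂ) : C(I, W) :=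
  ⟨fun t => x (α + ((t : ℝ) : ℂ)), by fun_prop⟩

lemma continuous_curveSegment {W : Type*} [TopologicalSpace W] (x : C(ℂ, W)) :
    Continuous (curveSegment x) := by
  refine ContinuousMap.continuous_of_continuous_uncurry _ ?_
  have : Continuous fun p : ℂ × I => x (p.1 + ((p.2 : ℝ) : ℂ)) := by fun_prop
  exact this

lemma differentiableOn_curveSegment {W : Type*} [NormedAddCommGroup W] [NormedSpace ℂ W]
    [CompleteSpace W] {x : C(ℂ, W)} {U : Set ℂ} (hU : IsOpen U)
    (hx : ∀ t : I, DifferentiableOn ℂ (fun α => x (α + ((t : ℝ) : ℂ))) U) :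
    DifferentiableOn ℂ (curveSegment x) U :=
  differentiableOn_continuousMap hU (continuous_curveSegment x).continuousOn hx

variable [FiniteDimensional ℂ E] {F : ℂ × E → E} (hF : Differentiable ℂ F) (B : E →L[ℂ] E →L[ℂ] ℂ)
  (Γ : C(ℂ, E))

/-- The linearization of `F` along the curve `Γ`, at the parameter `0`. -/
noncomputable def curveLinearization : C(ℂ, (ℂ × E) →L[ℂ] E) :=
  ⟨fun z => fderiv ℂ F (0, Γ z), (continuous_fderiv_of_holomorphic hF).comp (by fun_prop)⟩

/-- The functional `⟨F(0, Γ), ·⟩` which defines the phase condition. -/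
noncomputable def curveSection : C(ℂ, E →L[ℂ] ℂ) :=
  ⟨fun z => B (F (0, Γ z)), B.continuous.comp (hF.continuous.comp (by fun_prop))⟩

/-- The linear boundary value problem at the shift `α`. -/
noncomputable def shiftedOp (α : ℂ) : (ℂ × C(I, E)) →L[ℂ] (ℂ × C(I, E)) :=
  boundaryOp (curveSegment (curveLinearization hF Γ) α) (curveSegment (curveSection hF B Γ) α)

lemma continuous_shiftedOp : Continuous (shiftedOp hF B Γ) :=
  continuous_boundaryOp (continuous_curveSegment _) (continuous_curveSegment _)

/-- The nonlinear terms of the forced problem, with the forcing `G`. -/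
noncomputable def nonlinearity {G : ℝ → ℂ × E → E} (hG : Continuous (Function.uncurry G)) (α : ℂ)
    (u : ℂ × C(I, E)) : C(I, E) :=
  ⟨fun t => F (u.1, Γ (α + ((t : ℝ) : ℂ)) + u.2 t) - F (0, Γ (α + ((t : ℝ) : ℂ))) -
      fderiv ℂ F (0, Γ (α + ((t : ℝ) : ℂ))) (u.1, u.2 t) +
      G t (u.1, Γ (α + ((t : ℝ) : ℂ)) + u.2 t), by
    have h1 := hF.continuous
    have h2 := continuous_fderiv_of_holomorphic hF
    have h3 : Continuous fun t : I => G t (u.1, Γ (α + ((t : ℝ) : ℂ)) + u.2 t) :=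
      hG.comp (f := fun t : I => ((t : ℝ), (u.1, Γ (α + ((t : ℝ) : ℂ)) + u.2 t))) (by fun_prop)
    have h4 : Continuous fun t : I => fderiv ℂ F (0, Γ (α + ((t : ℝ) : ℂ))) (u.1, u.2 t) :=
      (h2.comp (by fun_prop)).clm_apply (by fun_prop)
    fun_prop⟩

/-- The fixed point operator of the forced problem. -/
noncomputable def fixedPointOp {G : ℝ → ℂ × E → E} (hG : Continuous (Function.uncurry G)) (α : ℂ)
    (u : ℂ × C(I, E)) : ℂ × C(I, E) :=
  Ring.inverse (shiftedOp hF B Γ α) (0, primitiveCLM E (nonlinearity hF Γ hG α u))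

variable {hF B Γ}

lemma fixedPointOp_eq_iff {G : ℝ → ℂ × E → E} (hG : Continuous (Function.uncurry G)) {α : ℂ}
    (hu : IsUnit (shiftedOp hF B Γ α)) (u : ℂ × C(I, E)) :
    fixedPointOp hF B Γ hG α u = u ↔
      shiftedOp hF B Γ α u = (0, primitiveCLM E (nonlinearity hF Γ hG α u)) := by
  constructor
  · intro h
    rw [← ring_inverse_apply hu (0, primitiveCLM E (nonlinearity hF Γ hG α u))]
    exact congrArg _ h.symm
  · intro h
    rw [fixedPointOp, ← h, ring_inverse_apply' hu]

lemma continuous_nonlinearity {G : ℝ → ℂ × E → E} (hG : Continuous (Function.uncurry G))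
    {v : ℂ → ℂ × C(I, E)} (hv : Continuous v) :
    Continuous fun α => nonlinearity hF Γ hG α (v α) := by
  refine ContinuousMap.continuous_of_continuous_uncurry _ ?_
  have hv1 : Continuous fun p : ℂ × I => (v p.1).1 := by fun_prop
  have hv2 : Continuous fun p : ℂ × I => (v p.1).2 p.2 := by fun_prop
  have hc : Continuous fun p : ℂ × I => Γ (p.1 + ((p.2 : ℝ) : ℂ)) := by fun_prop
  have e1 := hF.continuous.comp (hv1.prodMk (hc.add hv2))
  have e2 := hF.continuous.comp ((continuous_const (y := (0 : ℂ))).prodMk hc)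
  have e3 := ((continuous_fderiv_of_holomorphic hF).comp
    ((continuous_const (y := (0 : ℂ))).prodMk hc)).clm_apply (hv1.prodMk hv2)
  have e4 := hG.comp (Continuous.prodMk (f := fun p : ℂ × I => (p.2 : ℝ)) (by fun_prop)
    (hv1.prodMk (hc.add hv2)))
  exact ((e1.sub e2).sub e3).add e4

lemma continuous_fixedPointOp [CompleteSpace E] {G : ℝ → ℂ × E → E}
    (hG : Continuous (Function.uncurry G))
    (hu : ∀ α, IsUnit (shiftedOp hF B Γ α)) {v : ℂ → ℂ × C(I, E)} (hv : Continuous v) :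
    Continuous fun α => fixedPointOp hF B Γ hG α (v α) := by
  have h1 : Continuous fun α => Ring.inverse (shiftedOp hF B Γ α) := by
    rw [continuous_iff_continuousAt]
    intro α
    obtain ⟨w, hw⟩ := hu α
    have := NormedRing.inverse_continuousAt w
    rw [hw] at this
    exact this.comp (continuous_shiftedOp hF B Γ).continuousAt
  have h2 : Continuous fun α => nonlinearity hF Γ hG α (v α) := 
    continuous_nonlinearity hG hv
  exact h1.clm_apply (continuous_const.prodMk ((primitiveCLM E).continuous.comp h2))

lemma differentiableOn_shiftedOp [CompleteSpace E] {U : Set ℂ} (hU : IsOpen U)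
    (hΓ : ∀ t : I, DifferentiableOn ℂ (fun α => Γ (α + ((t : ℝ) : ℂ))) U) :
    DifferentiableOn ℂ (curveSegment (curveLinearization hF Γ)) U ∧
    DifferentiableOn ℂ (curveSegment (curveSection hF B Γ)) U := by
  have h0 : ∀ t : I, DifferentiableOn ℂ (fun α => ((0 : ℂ), Γ (α + ((t : ℝ) : ℂ)))) U :=
    fun t => (differentiableOn_const _).prodMk (hΓ t)
  exact ⟨differentiableOn_curveSegment hU fun t => differentiableOn_fderiv_comp hF hU (h0 t),
    differentiableOn_curveSegment hU fun t =>
      B.differentiable.comp_differentiableOn (hF.comp_differentiableOn (h0 t))⟩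

/-- The forcing is evaluated at real times only, and α enters through Γ(α + t). So holomorphy of
each G t in the state suffices, and holomorphy in the sup norm is checked for each t separately. -/
lemma differentiableOn_fixedPointOp [CompleteSpace E] {G : ℝ → ℂ × E → E}
    (hG : Continuous (Function.uncurry G))
    (hGd : ∀ t, Differentiable ℂ (G t)) (hu : ∀ α, IsUnit (shiftedOp hF B Γ α))
    {U : Set ℂ} (hU : IsOpen U)
    (hΓ : ∀ t : I, DifferentiableOn ℂ (fun α => Γ (α + ((t : ℝ) : ℂ))) U)
    {v : ℂ → ℂ × C(I, E)} (hv : DifferentiableOn ℂ v U) (hvc : Continuous v) :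
    DifferentiableOn ℂ (fun α => fixedPointOp hF B Γ hG α (v α)) U := by
  have h0 := differentiableOn_shiftedOp (hF := hF) (B := B) hU hΓ
  have h1 : DifferentiableOn ℂ (fun α => Ring.inverse (shiftedOp hF B Γ α)) U :=
    (differentiableOn_boundaryOp h0.1 h0.2).inverse fun α _ => hu α
  have h2 : DifferentiableOn ℂ (fun α => nonlinearity hF Γ hG α (v α)) U := by
    refine differentiableOn_continuousMap hU ?_ fun t => ?_
    · exact (continuous_nonlinearity hG hvc).continuousOn
    · have hv1 : DifferentiableOn ℂ (fun α => (v α).1) U := hv.fst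
      have hv2 : DifferentiableOn ℂ (fun α => (v α).2 t) U :=
        (ContinuousMap.evalCLM ℂ t : C(I, E) →L[ℂ] E).differentiable.comp_differentiableOn hv.snd
      have hc : DifferentiableOn ℂ (fun α => ((0 : ℂ), Γ (α + ((t : ℝ) : ℂ)))) U :=
        (differentiableOn_const _).prodMk (hΓ t)
      have hp := hv1.prodMk ((hΓ t).fun_add hv2)
      exact ((((hF.comp_differentiableOn hp).fun_sub (hF.comp_differentiableOn hc)).fun_sub
        ((differentiableOn_fderiv_comp hF hU hc).clm_apply (hv1.prodMk hv2))).fun_add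
        ((hGd t).comp_differentiableOn hp))
  exact h1.clm_apply ((differentiableOn_const _).prodMk
    ((primitiveCLM E).differentiable.comp_differentiableOn h2))

end ShiftedProblem

/-! ### The branch of fixed points: contraction estimates, continuity and holomorphy -/

section Branch

variable {E : Type*} [NormedAddCommGroup E] [NormedSpace ℂ E] [FiniteDimensional ℂ E]
  [CompleteSpace E] {F : ℂ × E → E} {hF : Differentiable ℂ F} {B : E →L[ℂ] E →L[ℂ] ℂ}
  {Γ : C(ℂ, E)}

omit [CompleteSpace E] in
/-- Lipschitz bounds for the fixed point operator follow from bounds on the forcing. -/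
lemma norm_fixedPointOp_sub_le {G : ℝ → ℂ × E → E} (hG : Continuous (Function.uncurry G))
    (hGd : ∀ t, Differentiable ℂ (G t)) {R M K κ r : ℝ} (hR : ∀ z, ‖Γ z‖ ≤ R)
    (hM : ∀ α, ‖Ring.inverse (shiftedOp hF B Γ α)‖ ≤ M)
    (hGK : ∀ t x, ‖x‖ ≤ R + 2 → ‖G t x‖ ≤ K) (hr1 : r ≤ 1)
    (hκ : ∀ x₀, ‖x₀‖ ≤ R → ∀ x ∈ closedBall (0 : ℂ × E) r, ∀ y ∈ closedBall (0 : ℂ × E) r,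
      ‖(F (x₀ + x) - fderiv ℂ F x₀ x) - (F (x₀ + y) - fderiv ℂ F x₀ y)‖ ≤ κ * ‖x - y‖)
    (hκ0 : 0 ≤ κ) (α : ℂ) {u v : ℂ × C(I, E)} (hu : u ∈ closedBall 0 r) (hv : v ∈ closedBall 0 r) :
    ‖fixedPointOp hF B Γ hG α u - fixedPointOp hF B Γ hG α v‖ ≤
      M * (κ + 2 * K) * ‖u - v‖ := by
  rw [mem_closedBall_zero_iff] at hu hv
  have hK0 : 0 ≤ K := (norm_nonneg _).trans (hGK 0 0 (by
    have := (norm_nonneg _).trans (hR 0); simp; linarith))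
  rw [fixedPointOp, fixedPointOp, ← map_sub, Prod.mk_sub_mk, sub_zero, ← map_sub, mul_assoc]
  refine (ContinuousLinearMap.le_of_opNorm_le_of_le _ (hM α) ?_)
  rw [Prod.norm_mk, norm_zero, max_eq_right (norm_nonneg _)]
  refine (norm_primitiveCLM_apply_le _).trans ?_
  rw [ContinuousMap.norm_le _ (by positivity)]
  intro t
  set c := Γ (α + ((t : ℝ) : ℂ)) with hc
  set x : ℂ × E := (u.1, u.2 t) with hx
  set y : ℂ × E := (v.1, v.2 t) with hy
  have hxr : ‖x‖ ≤ r := (norm_pair_le u t).trans hu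
  have hyr : ‖y‖ ≤ r := (norm_pair_le v t).trans hv
  have hxy : ‖x - y‖ ≤ ‖u - v‖ := norm_pair_le (u - v) t
  have hc0 : ‖((0 : ℂ), c)‖ ≤ R := by
    rw [Prod.norm_mk, norm_zero, max_eq_right (norm_nonneg _)]; exact hR _
  have e1 : ∀ w : ℂ × E, ((0 : ℂ), c) + w = (w.1, c + w.2) := fun w => by ext <;> simp
  have h1 := hκ _ hc0 x (mem_closedBall_zero_iff.2 hxr) y (mem_closedBall_zero_iff.2 hyr)
  -- Cauchy estimate with radius 1: a bound K on displacements of norm up to 2, hence on states of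
  -- norm up to R + 2, gives the Lipschitz constant 2K.
  have h2 := norm_sub_le_of_holomorphic_of_bound (h := fun w : ℂ × E => G t ((0, c) + w))
    ((hGd t).comp (by fun_prop)) one_pos (K := K) (fun w hw => hGK _ _ (by
      rw [mem_closedBall_zero_iff] at hw
      linarith [norm_add_le ((0 : ℂ), c) w])) (mem_closedBall_zero_iff.2 (hxr.trans hr1))
      (mem_closedBall_zero_iff.2 (hyr.trans hr1))
  rw [div_one] at h2
  simp only [e1] at h1 h2
  have e2 : (nonlinearity hF Γ hG α u - nonlinearity hF Γ hG α v) t =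
      ((F (x.1, c + x.2) - fderiv ℂ F (0, c) x) - (F (y.1, c + y.2) - fderiv ℂ F (0, c) y)) +
      (G t (x.1, c + x.2) - G t (y.1, c + y.2)) := by
    simp only [nonlinearity, ContinuousMap.sub_apply, ContinuousMap.coe_mk]
    abel
  rw [e2]
  refine (norm_add_le _ _).trans ?_
  calc _ ≤ κ * ‖x - y‖ + 2 * K * ‖x - y‖ := add_le_add h1 h2
    _ = (κ + 2 * K) * ‖x - y‖ := by ring
    _ ≤ (κ + 2 * K) * ‖u - v‖ := by gcongr

-- At zero parameter and zero deviation the terms coming from F cancel, so the defect is the forcing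
-- alone.
omit [CompleteSpace E] in
lemma norm_fixedPointOp_zero_le {G : ℝ → ℂ × E → E} (hG : Continuous (Function.uncurry G))
    {R M K : ℝ} (hR : ∀ z, ‖Γ z‖ ≤ R) (hM : ∀ α, ‖Ring.inverse (shiftedOp hF B Γ α)‖ ≤ M)
    (hGK : ∀ t x, ‖x‖ ≤ R + 2 → ‖G t x‖ ≤ K) (α : ℂ) :
    ‖fixedPointOp hF B Γ hG α 0‖ ≤ M * K := by
  have hR0 := (norm_nonneg _).trans (hR 0)
  have hK0 : 0 ≤ K := (norm_nonneg _).trans (hGK 0 0 (by simp; linarith))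
  refine (ContinuousLinearMap.le_of_opNorm_le_of_le _ (hM α) ?_)
  rw [Prod.norm_mk, norm_zero, max_eq_right (norm_nonneg _)]
  refine (norm_primitiveCLM_apply_le _).trans ?_
  rw [ContinuousMap.norm_le _ hK0]
  intro t
  have e : nonlinearity hF Γ hG α 0 t = G t (0, Γ (α + ((t : ℝ) : ℂ))) := by
    have : ((0 : ℂ), (0 : E)) = 0 := rfl
    simp [nonlinearity, this]
  rw [e]
  refine hGK _ _ ?_
  rw [Prod.norm_mk, norm_zero, max_eq_right (norm_nonneg _)]
  linarith [hR (α + ((t : ℝ) : ℂ))]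

/-- The branch of solutions of the shifted problems, for small forcing. -/
theorem exists_branch {G : ℕ → ℝ → ℂ × E → E} (hG : ∀ n, Continuous (Function.uncurry (G n)))
    (hGd : ∀ n t, Differentiable ℂ (G n t)) {R M : ℝ} (hR : ∀ z, ‖Γ z‖ ≤ R)
    (hu : ∀ α, IsUnit (shiftedOp hF B Γ α))
    (hM : ∀ α, ‖Ring.inverse (shiftedOp hF B Γ α)‖ ≤ M)
    (hGK : ∀ ρ, ∃ K, ∀ n t x, 1 ≤ n → ‖x‖ ≤ ρ → ‖G n t x‖ ≤ K / n) :
    ∃ r > 0, ∃ C : ℝ, ∀ᶠ n : ℕ in atTop, ∃ u : ℂ → ℂ × C(I, E),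
      (∀ α, ‖u α‖ ≤ C / n) ∧ (∀ α, fixedPointOp hF B Γ (hG n) α (u α) = u α) ∧
      (∀ α v, ‖v‖ ≤ r → fixedPointOp hF B Γ (hG n) α v = v → v = u α) ∧ Continuous u ∧
      (∀ U, IsOpen U → (∀ t : I, DifferentiableOn ℂ (fun α => Γ (α + ((t : ℝ) : ℂ))) U) →
        DifferentiableOn ℂ u U) ∧
      (∀ α S, IsClosed S → 0 ∈ S → MapsTo (fixedPointOp hF B Γ (hG n) α) S S → u α ∈ S) := by
  have hM0 : 0 ≤ M := (norm_nonneg _).trans (hM 0)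
  obtain ⟨K, hK⟩ := hGK (R + 2)
  -- The contraction constant is M(κ + 2K/n). This κ contributes at most 1/4, and MK/n ≤ 1/8
  -- contributes the other 1/4. The condition MK/n ≤ r/2 keeps the iterates in the ball of radius r.
  obtain ⟨r, hr, hr1, hκ⟩ := exists_linearization_error_lipschitz hF R
    (κ := 1 / (4 * (M + 1))) (by positivity)
  have hlim : Tendsto (fun n : ℕ => M * (K / n)) atTop (𝓝 0) := by
    simpa using (tendsto_const_div_atTop_nhds_zero_nat K).const_mul M
  refine ⟨r, hr, 2 * (M * K), ?_⟩
  filter_upwards [hlim.eventually (ge_mem_nhds (show (0 : ℝ) < r / 2 by positivity)),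
    hlim.eventually (ge_mem_nhds (show (0 : ℝ) < 1 / 8 by positivity)), eventually_ge_atTop 1]
    with n hn1 hn2 hn3
  obtain ⟨u, hu1, hu2, hu3, hu4, hu5⟩ := exists_fixedPoint_of_uniform_contraction
    (fixedPointOp hF B Γ (hG n)) (m := M * (K / n)) (r := r)
    (fun α => norm_fixedPointOp_zero_le (hG n) hR hM (fun t x hx => hK n t x hn3 hx) α)
    (by linarith) (fun α v hv w hw => by
      refine (norm_fixedPointOp_sub_le (hG n) (hGd n) hR hM (fun t x hx => hK n t x hn3 hx)
        hr1 hκ (by positivity) α hv hw).trans ?_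
      gcongr
      have h1 : M * (1 / (4 * (M + 1))) ≤ 1 / 4 := by
        rw [mul_one_div, div_le_iff₀ (by positivity)]; linarith
      linarith)
  have hcont : ∀ k, Continuous fun α => (fixedPointOp hF B Γ (hG n) α)^[k] 0 := by
    intro k
    induction k with
    | zero => exact continuous_const
    | succ k ih =>
      simp only [Function.iterate_succ_apply']
      exact continuous_fixedPointOp (hG n) hu ih
  refine ⟨u, fun α => (hu1 α).trans (le_of_eq (by ring)), hu2, hu3,
    hu5.continuous (Frequently.of_forall hcont), fun U hU hΓ => ?_, fun α S hS h0 hmaps => ?_⟩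
  -- Weierstrass: a uniform limit of holomorphic iterates is holomorphic, so no implicit function
  -- theorem is needed.
  · refine (hu5.tendstoUniformlyOn (s := U)).tendstoLocallyUniformlyOn.differentiableOn
      (Eventually.of_forall fun k => ?_) hU
    induction k with
    | zero => exact differentiableOn_const _
    | succ k ih =>
      simp only [Function.iterate_succ_apply']
      exact differentiableOn_fixedPointOp (hG n) (hGd n) hu hU hΓ ih (hcont k)
  · refine hS.mem_of_tendsto (hu5.tendsto_at α) (Eventually.of_forall fun k => ?_)
    induction k with
    | zero => exact h0
    | succ k ih =>
      rw [Function.iterate_succ_apply']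
      exact hmaps ih

end Branch

/-! ### Periodic solutions and the integral equation on a period -/

section Periodic

variable {E : Type*} [NormedAddCommGroup E] [NormedSpace ℝ E] [CompleteSpace E]

/-- A periodic solution satisfies the integral equation. -/
lemma sub_eq_integral_of_hasDerivAt {z : ℝ → E} {h : ℝ → E → E}
    (hh : Continuous (Function.uncurry h)) (hz : Function.Periodic z 1)
    (hd : ∀ t, HasDerivAt z (h t (z t)) t) (t : ℝ) :
    z t - z 1 = ∫ s in (0 : ℝ)..t, h s (z s) := by
  have hzc : Continuous z := continuous_iff_continuousAt.2 fun t => (hd t).continuousAt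
  have h1 : z 1 = z 0 := by simpa using hz 0
  rw [h1, intervalIntegral.integral_eq_sub_of_hasDerivAt (fun s _ => hd s)
    (Continuous.intervalIntegrable (hh.comp (continuous_id.prodMk hzc)) _ _)]

/-- A solution of the integral equation on a period extends to a periodic solution. -/
theorem exists_periodic_solution (ζ : C(I, E)) {h : ℝ → E → E}
    (hh : Continuous (Function.uncurry h)) (hper : ∀ t x, h (t + 1) x = h t x)
    (hζ : ∀ t : I, ζ t - ζ 1 = ∫ s in (0 : ℝ)..t, IccExtend zero_le_one (fun s : I => h s (ζ s)) s) :
    ∃ z : ℝ → E, Function.Periodic z 1 ∧ (∀ t : I, z t = ζ t) ∧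
      ∀ t, HasDerivAt z (h t (z t)) t := by
  -- Periodicity is encoded in the integral equation: at t = 0 it says ζ(0) = ζ(1), and at t = 1 it
  -- says that the right hand side has integral zero over a period.
  have h01 : ζ 0 = ζ 1 := by
    have := hζ 0
    simpa [sub_eq_zero] using this
  set w : ℝ → E := fun t => IccExtend zero_le_one ζ (Int.fract t) with hw
  have hwI : ∀ t : I, w t = ζ t := by
    intro t
    rcases eq_or_lt_of_le t.2.2 with ht | ht
    · obtain rfl : t = 1 := Subtype.ext ht
      change IccExtend zero_le_one ζ (Int.fract (1 : ℝ)) = ζ 1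
      rw [Int.fract_one, IccExtend_left, ← h01]
      rfl
    · change IccExtend zero_le_one ζ (Int.fract (t : ℝ)) = ζ t
      rw [Int.fract_eq_self.2 ⟨t.2.1, ht⟩, IccExtend_val]
  have hwc : Continuous w := by
    refine ContinuousOn.comp_fract'' (ζ.continuous.Icc_extend').continuousOn ?_
    simpa using h01
  have hwp : Function.Periodic w 1 := fun t => by simp [hw]
  set k : ℝ → E := fun s => h s (w s) with hk
  have hkc : Continuous k := hh.comp (continuous_id.prodMk hwc)
  have hkp : Function.Periodic k 1 := fun t => by simp only [hk, hper, hwp t]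
  have hζ' : ∀ t : I, ζ t - ζ 1 = ∫ s in (0 : ℝ)..t, k s := by
    intro t
    rw [hζ]
    refine intervalIntegral.integral_congr fun s hs => ?_
    rw [uIcc_of_le t.2.1] at hs
    have hs' : s ∈ I := ⟨hs.1, hs.2.trans t.2.2⟩
    simp only [hk]
    rw [IccExtend_of_mem _ _ hs', ← hwI ⟨s, hs'⟩]
  have hk0 : ∫ s in (0 : ℝ)..1, k s = 0 := by
    have := hζ' 1
    rw [sub_self] at this
    exact this.symm
  -- The periodic extension w is only known to be continuous. The primitive z is differentiable and,
  -- since the integrand has mean zero, also periodic; both agree on one period and hence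
  -- everywhere.
  set z : ℝ → E := fun t => ζ 1 + ∫ s in (0 : ℝ)..t, k s with hz
  have hzI : ∀ t : I, z t = ζ t := fun t => by simp only [hz, ← hζ' t]; abel
  have hzp : Function.Periodic z 1 := by
    intro t
    simp only [hz]
    rw [← intervalIntegral.integral_add_adjacent_intervals (b := t)
      (hkc.intervalIntegrable _ _) (hkc.intervalIntegrable _ _),
      hkp.intervalIntegral_add_eq t 0, zero_add, hk0, add_zero]
  have hzw : ∀ t, z t = w t := by
    intro t
    have h1 : z (Int.fract t) = z t := by
      have := hzp.sub_int_mul_eq (x := t) ⌊t⌋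
      rwa [mul_one, Int.self_sub_floor] at this
    have h2 : w (Int.fract t) = w t := by simp [hw]
    rw [← h1, ← h2]
    have hf : Int.fract t ∈ I := ⟨Int.fract_nonneg t, (Int.fract_lt_one t).le⟩
    exact (hzI ⟨_, hf⟩).trans (hwI ⟨_, hf⟩).symm
  refine ⟨z, hzp, hzI, fun t => ?_⟩
  rw [hzw t]
  exact (intervalIntegral.integral_hasDerivAt_right (hkc.intervalIntegrable _ _)
    hkc.stronglyMeasurable.stronglyMeasurableAtFilter hkc.continuousAt).const_add _

end Periodic

/-! ### Periodic holomorphic functions on strips -/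

section Strip

open Complex in
/-- The integral of a periodic holomorphic function over a period does not change under imaginary
shifts. -/
lemma integral_period_eq_of_differentiableOn_strip {g : ℂ → ℂ} {H y : ℝ}
    (hg : DifferentiableOn ℂ g {w | |w.im| < H}) (hper : ∀ w : ℂ, |w.im| < H → g (w + 1) = g w)
    (hy : |y| < H) :
    ∫ x in (0 : ℝ)..1, g x = ∫ x in (0 : ℝ)..1, g (x + y * Complex.I) := by
  have h := integral_boundary_rect_eq_zero_of_differentiableOn g 0 (1 + y * Complex.I) (hg.mono ?_)
  · have h1 : ∫ t in (0 : ℝ)..y, g (1 + t * Complex.I) = ∫ t in (0 : ℝ)..y, g (t * Complex.I) := by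
      refine intervalIntegral.integral_congr fun t ht => ?_
      rw [add_comm]
      refine hper _ ?_
      have : |t| ≤ |y| := by
        rw [mem_uIcc] at ht
        rcases ht with ht | ht
        · exact abs_le_abs_of_nonneg ht.1 ht.2
        · exact abs_le_abs_of_nonpos ht.2 ht.1
      simpa using this.trans_lt hy
    simp [h1] at h
    exact sub_eq_zero.1 h
  · intro w hw
    rw [mem_reProdIm] at hw
    have h2 := hw.2
    have : |w.im| ≤ |y| := by
      simp only [zero_im, add_im, one_im, mul_im, ofReal_re, I_im, mul_one, ofReal_im, I_re,
        mul_zero, add_zero, zero_add] at h2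
      rw [mem_uIcc] at h2
      rcases h2 with ht | ht
      · exact abs_le_abs_of_nonneg ht.1 ht.2
      · exact abs_le_abs_of_nonpos ht.2 ht.1
    exact this.trans_lt hy

open Complex in
-- The line of integration is moved by H into the half plane in which the factor exp(-2πikw), of
-- modulus exp(2πk Im w), decays.
lemma norm_fourierCoeff_le_of_strip {ψ : ℂ → ℂ} {H H' r : ℝ} (hH : 0 < H) (hHH' : H < H')
    (hψ : DifferentiableOn ℂ ψ {w | |w.im| < H'}) (hper : ∀ w : ℂ, |w.im| < H' → ψ (w + 1) = ψ w)
    (hr : ∀ w : ℂ, |w.im| < H' → ‖ψ w‖ ≤ r) {f : UnitAddCircle → ℂ} (hf : ∀ x : ℝ, f x = ψ x)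
    (k : ℤ) : ‖fourierCoeff f k‖ ≤ r * Real.exp (-(2 * Real.pi * H)) ^ k.natAbs := by
  have hf1 : fourierCoeff f k =
      ∫ x in (0 : ℝ)..1, (fun w : ℂ => exp (-(2 * Real.pi * Complex.I * k * w)) * ψ w) x := by
    rw [fourierCoeff_eq_intervalIntegral f k 0]
    simp only [one_div, inv_one, one_smul, zero_add]
    refine intervalIntegral.integral_congr fun x _ => ?_
    simp only [hf, fourier_coe_apply, smul_eq_mul]
    congr 2
    push_cast
    ring
  -- The sign of y is opposite to that of k.
  obtain ⟨y, hy, hky⟩ : ∃ y : ℝ, |y| = H ∧ (k : ℝ) * y = -(k.natAbs * H) := by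
    rcases le_total 0 k with hk | hk
    · refine ⟨-H, by rw [abs_neg, abs_of_pos hH], ?_⟩
      rw [Nat.cast_natAbs, abs_of_nonneg hk]; ring
    · refine ⟨H, abs_of_pos hH, ?_⟩
      rw [Nat.cast_natAbs, abs_of_nonpos hk]; push_cast; ring
  rw [hf1, integral_period_eq_of_differentiableOn_strip (H := H') (y := y)
    (g := fun w : ℂ => exp (-(2 * Real.pi * Complex.I * k * w)) * ψ w) ?_ ?_ (hy.trans_lt hHH')]
  · refine (intervalIntegral.norm_integral_le_of_norm_le_const
      (C := r * Real.exp (-(2 * Real.pi * H)) ^ k.natAbs) fun x _ => ?_).trans (by simp)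
    have him : |((x : ℂ) + y * Complex.I).im| < H' := by simpa [hy] using hHH'
    rw [norm_mul, norm_exp, mul_comm, ← Real.exp_nat_mul]
    have e : (-(2 * Real.pi * Complex.I * k * ((x : ℂ) + y * Complex.I))).re =
        k.natAbs * (-(2 * Real.pi * H)) := by
      have : (-(2 * Real.pi * Complex.I * k * ((x : ℂ) + y * Complex.I))) =
          ((2 * Real.pi * (k * y) : ℝ) : ℂ) + ((-(2 * Real.pi * k * x) : ℝ) : ℂ) * Complex.I := by
        push_cast
        ring_nf
        rw [I_sq]
        ring
      rw [this, Complex.add_re, Complex.ofReal_re, Complex.re_ofReal_mul, Complex.I_re, mul_zero, add_zero, hky]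
      ring
    rw [e]
    gcongr
    exact hr _ him
  · exact (Differentiable.differentiableOn (by fun_prop)).mul hψ
  · intro w hw
    rw [hper w hw]
    congr 1
    rw [mul_add, mul_one, neg_add, exp_add]
    have : exp (-(2 * Real.pi * Complex.I * k)) = 1 := by
      rw [exp_eq_one_iff]
      exact ⟨-k, by push_cast; ring⟩
    rw [this, mul_one]

/-- A bounded `1`-periodic holomorphic function on a wide strip is almost constant. -/
theorem norm_sub_le_of_periodic_strip {ψ : ℂ → ℂ} {H H' r : ℝ} (hH : 0 < H) (hHH' : H < H')
    (hψ : DifferentiableOn ℂ ψ {w | |w.im| < H'}) (hper : ∀ w : ℂ, |w.im| < H' → ψ (w + 1) = ψ w)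
    (hr : ∀ w : ℂ, |w.im| < H' → ‖ψ w‖ ≤ r) (x y : ℝ) :
    ‖ψ x - ψ y‖ ≤ 4 * r * (Real.exp (-(2 * Real.pi * H)) / (1 - Real.exp (-(2 * Real.pi * H)))) := by
  set q := Real.exp (-(2 * Real.pi * H)) with hq
  have hq0 : 0 < q := Real.exp_pos _
  have hq1 : q < 1 := by
    rw [hq, Real.exp_lt_one_iff]
    have := Real.pi_pos
    have : 0 < 2 * Real.pi * H := by positivity
    linarith
  have hr0 : 0 ≤ r := (norm_nonneg _).trans (hr 0 (by simpa using hH.trans hHH'))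
  have hp : Function.Periodic (fun x : ℝ => ψ x) 1 := fun x => by
    have := hper x (by simpa using hH.trans hHH')
    simpa using this
  have hc : Continuous fun x : ℝ => ψ x := by
    refine hψ.continuousOn.comp_continuous (by fun_prop) fun x => ?_
    simpa using hH.trans hHH'
  let f : C(UnitAddCircle, ℂ) := ⟨hp.lift, continuous_coinduced_dom.2 hc⟩
  have hf : ∀ x : ℝ, f x = ψ x := fun x => hp.lift_coe x
  have hcoef := norm_fourierCoeff_le_of_strip hH hHH' hψ hper hr hf
  set a : ℤ → ℝ := fun k => r * q ^ k.natAbs with ha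
  have hgeo := hasSum_geometric_of_lt_one hq0.le hq1
  have ha1 : HasSum (fun n : ℕ => a n) (r * (1 - q)⁻¹) := by
    simpa [ha] using hgeo.mul_left r
  have ha2 : HasSum (fun n : ℕ => a (-((n : ℤ) + 1))) (r * (q * (1 - q)⁻¹)) := by
    have e : (fun n : ℕ => a (-((n : ℤ) + 1))) = fun n => r * (q * q ^ n) := by
      funext n
      have : (-((n : ℤ) + 1)).natAbs = n + 1 := by omega
      simp only [ha, this, pow_succ']
    rw [e]
    exact (hgeo.mul_left q).mul_left r
  have hsa := HasSum.of_nat_of_neg_add_one ha1 ha2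
  have hsum : Summable (fourierCoeff f) := Summable.of_norm_bounded hsa.summable hcoef
  have hx := has_pointwise_sum_fourier_series_of_summable hsum (x : UnitAddCircle)
  have hy := has_pointwise_sum_fourier_series_of_summable hsum (y : UnitAddCircle)
  rw [hf] at hx hy
  -- The mode k = 0 cancels in ψ(x) - ψ(y), so its bound r is removed from the series. What remains
  -- is 2 · Σ_{k≠0} r q^|k| = 4rq/(1 - q).
  have hb := (hsa.sub (hasSum_ite_eq (0 : ℤ) r)).mul_left 2
  refine ((hx.sub hy).norm_le_of_bounded hb fun k => ?_).trans (le_of_eq ?_)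
  · by_cases hk : k = 0
    · subst hk
      simp [ha]
    · rw [if_neg hk, sub_zero, ← smul_sub, smul_eq_mul, norm_mul, mul_comm 2]
      refine mul_le_mul (hcoef k) ?_ (norm_nonneg _) (by positivity)
      refine (norm_sub_le _ _).trans (le_of_eq ?_)
      rw [fourier_apply, fourier_apply, Circle.norm_coe, Circle.norm_coe]
      norm_num
  · have : (1 - q) ≠ 0 := by linarith
    field_simp
    ring

/-- The oscillation of a `1/n`-periodic holomorphic function on a strip is exponentially small. -/
theorem norm_sub_le_exp_of_periodic_strip {φ : ℂ → ℂ} {η r : ℝ} {n : ℕ} (hη : 0 < η) (hn : 1 ≤ n)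
    (hφ : DifferentiableOn ℂ φ {w | |w.im| < η / 2})
    (hper : ∀ w : ℂ, |w.im| < η / 2 → φ (w + 1 / n) = φ w)
    (hr : ∀ w : ℂ, |w.im| < η / 2 → ‖φ w‖ ≤ r) (x y : ℝ) :
    ‖φ x - φ y‖ ≤ 4 * r / (1 - Real.exp (-η)) * Real.exp (-η / (1 / (n : ℝ))) := by
  have hn0 : (0 : ℝ) < n := by exact_mod_cast hn
  have hn1 : (1 : ℝ) ≤ n := by exact_mod_cast hn
  have hnc : (n : ℂ) ≠ 0 := by exact_mod_cast hn0.ne'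
  have him : ∀ w : ℂ, |w.im| < n * (η / 2) → |(w / n).im| < η / 2 := fun w hw => by
    rw [Complex.div_natCast_im, abs_div, abs_of_pos hn0, div_lt_iff₀ hn0]
    linarith
  have hr0 : 0 ≤ r := (norm_nonneg _).trans (hr 0 (by simpa using hη))
  -- Rescaling to period 1 widens the strip by the factor n. The contour height nη/4 lies strictly
  -- inside the half-width nη/2.
  have h := norm_sub_le_of_periodic_strip (ψ := fun w => φ (w / n)) (H := n * (η / 4))
    (H' := n * (η / 2)) (by positivity) (by gcongr; norm_num)
    (hφ.comp (f := fun w : ℂ => w / n) (Differentiable.differentiableOn (by fun_prop))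
      fun w hw => him w hw)
    (fun w hw => by simp only [add_div]; exact hper _ (him w hw))
    (fun w hw => hr _ (him w hw)) (n * x) (n * y)
  have e : ∀ t : ℝ, ((n * t : ℝ) : ℂ) / n = t := fun t => by push_cast; field_simp
  simp only [e] at h
  refine h.trans ?_
  rw [div_mul_eq_mul_div, ← mul_div_assoc]
  -- Here 2π/4 > 1 makes up for having used only a quarter of the height η.
  have hq : Real.exp (-(2 * Real.pi * (n * (η / 4)))) ≤ Real.exp (-η / (1 / (n : ℝ))) := by
    rw [Real.exp_le_exp, div_div_eq_mul_div, div_one, neg_mul, neg_le_neg_iff]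
    nlinarith [Real.pi_gt_three, mul_pos hn0 hη]
  have hq2 : Real.exp (-η / (1 / (n : ℝ))) ≤ Real.exp (-η) := by
    rw [Real.exp_le_exp, div_div_eq_mul_div, div_one, neg_mul, neg_le_neg_iff]
    nlinarith
  have hq3 : Real.exp (-η) < 1 := by rw [Real.exp_lt_one_iff]; linarith
  exact div_le_div₀ (by positivity) (by gcongr) (by linarith) (by linarith [hq.trans hq2])

end Strip

/-- Functions of period `1` which agree on a period are equal. -/
lemma Function.Periodic.ext_unitInterval {β : Type*} {f g : ℝ → β} (hf : Function.Periodic f 1)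
    (hg : Function.Periodic g 1) (h : ∀ t : I, f t = g t) : f = g := by
  funext t
  have h1 := hf.sub_int_mul_eq (x := t) ⌊t⌋
  have h2 := hg.sub_int_mul_eq (x := t) ⌊t⌋
  rw [mul_one, Int.self_sub_floor] at h1 h2
  rw [← h1, ← h2]
  exact h ⟨Int.fract t, Int.fract_nonneg t, (Int.fract_lt_one t).le⟩

/-! ### Invertibility of the linearized problem at complex shifts -/

section ShiftedInvertibility

variable {E : Type*} [NormedAddCommGroup E] [NormedSpace ℂ E] [FiniteDimensional ℂ E]
  {F : ℂ × E → E} {hF : Differentiable ℂ F} {B : E →L[ℂ] E →L[ℂ] ℂ} {Γ : C(ℂ, E)}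

lemma shiftedOp_fst (α : ℂ) (u : ℂ × C(I, E)) {z : ℝ → E} (hz : ∀ t : I, z t = u.2 t) :
    (shiftedOp hF B Γ α u).1 = ∫ s in (0 : ℝ)..1, B (F (0, Γ (α + s))) (z s) := by
  rw [shiftedOp, boundaryOp_fst]
  refine intervalIntegral.integral_congr fun s hs => ?_
  rw [uIcc_of_le zero_le_one] at hs
  rw [IccExtend_of_mem _ _ hs, ← hz]
  rfl

lemma shiftedOp_snd_eq_iff (α : ℂ) (u : ℂ × C(I, E)) {Q : C(I, E)} {h : ℝ → E → E}
    (hQ : ∀ s : I, h s (u.2 s) = fderiv ℂ F (0, Γ (α + ((s : ℝ) : ℂ))) (u.1, u.2 s) + Q s) (t : I) :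
    (shiftedOp hF B Γ α u).2 t = primitiveCLM E Q t ↔ u.2 t - u.2 1 =
      ∫ s in (0 : ℝ)..t, IccExtend zero_le_one (fun s : I => h s (u.2 s)) s := by
  rw [shiftedOp, boundaryOp_snd, sub_eq_iff_eq_add, primitiveCLM_apply,
    ← intervalIntegral.integral_add]
  · have : ∀ s, IccExtend zero_le_one (fun s : I => h s (u.2 s)) s =
        IccExtend zero_le_one Q s + IccExtend zero_le_one
          (fun s : I => curveSegment (curveLinearization hF Γ) α s (u.1, u.2 s)) s := by
      intro s
      simp only [IccExtend, Function.comp_apply, hQ]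
      rw [add_comm]
      rfl
    simp only [this]
  · exact (Q.continuous.Icc_extend').intervalIntegrable _ _
  · refine (Continuous.Icc_extend' ?_).intervalIntegrable _ _
    exact (curveSegment (curveLinearization hF Γ) α).continuous.clm_apply (by fun_prop)

/-- The integral form of the shifted problem describes periodic solutions of the differential
equation which satisfy the phase condition. -/
theorem shiftedOp_eq_iff [CompleteSpace E] (α : ℂ) (u : ℂ × C(I, E)) {Q : C(I, E)} {h : ℝ → E → E}
    (hh : Continuous (Function.uncurry h)) (hper : ∀ t x, h (t + 1) x = h t x)
    (hQ : ∀ s : I, h s (u.2 s) = fderiv ℂ F (0, Γ (α + ((s : ℝ) : ℂ))) (u.1, u.2 s) + Q s) :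
    shiftedOp hF B Γ α u = (0, primitiveCLM E Q) ↔
      ∃ z : ℝ → E, Function.Periodic z 1 ∧ (∀ t : I, z t = u.2 t) ∧
        (∀ t, HasDerivAt z (h t (z t)) t) ∧
        ∫ s in (0 : ℝ)..1, B (F (0, Γ (α + s))) (z s) = 0 := by
  constructor
  · intro hu
    obtain ⟨z, hz1, hz2, hz3⟩ := exists_periodic_solution u.2 hh hper fun t =>
      (shiftedOp_snd_eq_iff (hF := hF) (B := B) α u hQ t).1 (by rw [hu])
    exact ⟨z, hz1, hz2, hz3, by rw [← shiftedOp_fst (hF := hF) α u hz2, hu]⟩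
  · rintro ⟨z, hz1, hz2, hz3, hz4⟩
    refine Prod.ext ((shiftedOp_fst α u hz2).trans hz4) (ContinuousMap.ext fun t => ?_)
    refine (shiftedOp_snd_eq_iff α u hQ t).2 ?_
    rw [← hz2, ← hz2, show ((1 : I) : ℝ) = 1 from rfl, sub_eq_integral_of_hasDerivAt hh hz1 hz3]
    refine intervalIntegral.integral_congr fun s hs => ?_
    rw [uIcc_of_le t.2.1] at hs
    have hs' : s ∈ I := ⟨hs.1, hs.2.trans t.2.2⟩
    rw [IccExtend_of_mem _ _ hs', ← hz2 ⟨s, hs'⟩]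

/-- The kernel of the shifted operator consists of the periodic solutions of the linearized
equation which satisfy the phase condition. -/
theorem shiftedOp_eq_zero_iff [CompleteSpace E] (hΓ : ∀ z, Γ (z + 1) = Γ z) (α : ℂ)
    (u : ℂ × C(I, E)) : shiftedOp hF B Γ α u = 0 ↔
      ∃ z : ℝ → E, Function.Periodic z 1 ∧ (∀ t : I, z t = u.2 t) ∧
        (∀ t : ℝ, HasDerivAt z (fderiv ℂ F (0, Γ (α + t)) (u.1, z t)) t) ∧
        ∫ s in (0 : ℝ)..1, B (F (0, Γ (α + s))) (z s) = 0 := by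
  have h0 : (0 : ℂ × C(I, E)) = (0, primitiveCLM E 0) := by rw [map_zero]; rfl
  rw [h0]
  refine shiftedOp_eq_iff α u (h := fun t x => fderiv ℂ F (0, Γ (α + t)) (u.1, x)) ?_ ?_ ?_
  · have := continuous_fderiv_of_holomorphic hF
    exact (this.comp (g := fderiv ℂ F) (f := fun p : ℝ × E => ((0 : ℂ), Γ (α + p.1)))
      (by fun_prop)).clm_apply (by fun_prop)
  · intro t x
    rw [← hΓ (α + t)]
    push_cast
    rw [add_assoc]
  · intro s
    simp

/-- The homogeneous linear problem contains no forcing, so it is invariant under simultaneous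
translation of time and phase: if z lies in the kernel at α + s, then z(· - s) lies in the kernel at
α. Periodicity of the integrand preserves the phase condition. -/
theorem shiftedOp_injective_add_ofReal [CompleteSpace E] (hΓ : ∀ z, Γ (z + 1) = Γ z) {α : ℂ}
    (s : ℝ) (h : ∀ u, shiftedOp hF B Γ α u = 0 → u = 0) (u : ℂ × C(I, E))
    (hu : shiftedOp hF B Γ (α + s) u = 0) : u = 0 := by
  obtain ⟨z, hz1, hz2, hz3, hz4⟩ := (shiftedOp_eq_zero_iff hΓ _ u).1 hu
  have hzc : Continuous z := continuous_iff_continuousAt.2 fun t => (hz3 t).continuousAt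
  have hshift : ∀ t : ℝ, α + s + ((t - s : ℝ) : ℂ) = α + t := fun t => by push_cast; ring
  have hzs : ∀ t, z (t + 1 - s) = z (t - s) := fun t => by
    rw [← hz1 (t - s)]
    congr 1
    ring
  have h1 : ((u.1, ⟨fun t : I => z (t - s), by fun_prop⟩) : ℂ × C(I, E)) = 0 := by
    refine h _ ((shiftedOp_eq_zero_iff hΓ _ _).2 ⟨fun t => z (t - s), fun t => ?_, fun t => rfl,
      fun t => ?_, ?_⟩)
    · exact hzs t
    · have := (hz3 (t - s)).comp_sub_const t s
      rw [hshift] at this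
      exact this
    · let k : ℝ → ℂ := fun t => B (F (0, Γ (α + s + t))) (z t)
      have hk : Function.Periodic k 1 := by
        intro t
        simp only [k, hz1 t]
        rw [← hΓ (α + s + t)]
        push_cast
        rw [add_assoc _ _ (1 : ℂ)]
      have e : ∀ t : ℝ, B (F (0, Γ (α + t))) (z (t - s)) = k (t - s) := by
        intro t
        simp only [k]
        rw [hshift]
      simp only [e]
      rw [intervalIntegral.integral_comp_sub_right k s]
      have := hk.intervalIntegral_add_eq (0 - s) 0
      rw [zero_add] at this
      rw [show (1 : ℝ) - s = 0 - s + 1 by ring, this]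
      exact hz4
  have h2 : (fun t => z (t - s)) = fun _ => 0 := by
    refine Function.Periodic.ext_unitInterval (fun t => ?_) (fun t => rfl) fun t => ?_
    · exact hzs t
    · exact DFunLike.congr_fun (congrArg Prod.snd h1) t
  refine Prod.ext (show u.1 = 0 from congrArg (fun v : ℂ × C(I, E) => v.1) h1)
    (ContinuousMap.ext fun t => ?_)
  have h3 := congrFun h2 (t + s)
  simp only [add_sub_cancel_right] at h3
  rw [← hz2, h3]
  rfl

theorem isUnit_shiftedOp_of_injective [CompleteSpace E] {α : ℂ}
    (h : ∀ u, shiftedOp hF B Γ α u = 0 → u = 0) : IsUnit (shiftedOp hF B Γ α) :=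
  isUnit_boundaryOp_of_boundaryDet_ne_zero (boundaryDet_ne_zero h)

theorem shiftedOp_injective_of_isUnit {α : ℂ} (h : IsUnit (shiftedOp hF B Γ α))
    (u : ℂ × C(I, E)) (hu : shiftedOp hF B Γ α u = 0) : u = 0 := by
  rw [← ring_inverse_apply' h u, hu, map_zero]

/-- Invertibility at one real shift implies invertibility at all complex shifts in a strip in which
the curve is holomorphic: the characteristic determinant is holomorphic, and its zero set is
invariant under real shifts. -/
theorem isUnit_shiftedOp_of_strip [CompleteSpace E] (hΓ : ∀ z, Γ (z + 1) = Γ z) {η : ℝ}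
    (hd : DifferentiableOn ℂ Γ {z | |z.im| < η}) (h0 : ∀ u, shiftedOp hF B Γ 0 u = 0 → u = 0)
    {α : ℂ} (hα : |α.im| < η) : IsUnit (shiftedOp hF B Γ α) := by
  set U : Set ℂ := {z | |z.im| < η} with hU
  have hUo : IsOpen U := isOpen_lt (by fun_prop) continuous_const
  have hUc : Convex ℝ U := by
    have : U = Complex.imLm ⁻¹' (Ioo (-η) η) := by
      ext z; simp [hU, abs_lt]
    rw [this]
    exact (convex_Ioo _ _).linear_preimage _
  have hd' : ∀ t : I, DifferentiableOn ℂ (fun α => Γ (α + ((t : ℝ) : ℂ))) U := fun t =>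
    hd.comp (f := fun α : ℂ => α + ((t : ℝ) : ℂ)) (Differentiable.differentiableOn (by fun_prop))
      fun z hz => by simpa [hU] using hz
  have hs := differentiableOn_shiftedOp (hF := hF) (B := B) hUo hd'
  set d : ℂ → ℂ := fun α => boundaryDet (curveSegment (curveLinearization hF Γ) α)
    (curveSegment (curveSection hF B Γ) α) with hdet
  have hdd : DifferentiableOn ℂ d U := differentiableOn_boundaryDet hs.1 hs.2
  refine isUnit_boundaryOp_of_boundaryDet_ne_zero fun hzero => ?_
  have hline : ∀ s : ℝ, d (α + s) = 0 := by
    intro s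
    by_contra hne
    have h1 := shiftedOp_injective_of_isUnit (hF := hF) (B := B) (Γ := Γ) (α := α + s)
      (isUnit_boundaryOp_of_boundaryDet_ne_zero hne)
    have h2 := shiftedOp_injective_add_ofReal hΓ (-s) h1
    have e : α + (s : ℂ) + ((-s : ℝ) : ℂ) = α := by push_cast; ring
    rw [e] at h2
    exact boundaryDet_ne_zero h2 hzero
  -- The horizontal line of zeros accumulates at α, so d vanishes on the whole strip, in particular
  -- at the shift 0, where it is nonzero by `h0`.
  have hfreq : ∃ᶠ z in 𝓝[≠] α, d z = 0 := by
    have ht : Tendsto (fun s : ℝ => α + (s : ℂ)) (𝓝[≠] 0) (𝓝[≠] α) := by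
      refine tendsto_nhdsWithin_iff.2 ⟨?_, ?_⟩
      · have : Continuous fun s : ℝ => α + (s : ℂ) := by fun_prop
        simpa using (this.tendsto 0).mono_left nhdsWithin_le_nhds
      · filter_upwards [self_mem_nhdsWithin] with s hs
        simpa using hs
    exact ht.frequently (Frequently.of_forall hline)
  have h3 := (hdd.analyticOnNhd hUo).eqOn_zero_of_preconnected_of_frequently_eq_zero
    hUc.isPreconnected hα hfreq
  have hη : 0 < η := (abs_nonneg _).trans_lt hα
  exact boundaryDet_ne_zero h0 (h3 (show (0 : ℂ) ∈ U by simpa [hU] using hη))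

/-- The nearest point projection onto the strip `|Im z| ≤ b`. -/
noncomputable def stripProj (b : ℝ) : C(ℂ, ℂ) :=
  ⟨fun z => z.re + ((max (-b) (min b z.im) : ℝ) : ℂ) * Complex.I, by fun_prop⟩

lemma stripProj_add_ofReal (b : ℝ) (z : ℂ) (t : ℝ) :
    stripProj b (z + t) = stripProj b z + t := by
  simp [stripProj]; ring

lemma abs_stripProj_im_le {b : ℝ} (hb : 0 ≤ b) (z : ℂ) : |(stripProj b z).im| ≤ b := by
  have : (stripProj b z).im = max (-b) (min b z.im) := by simp [stripProj]
  rw [this, abs_le]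
  exact ⟨le_max_left _ _, max_le (by linarith) (min_le_left _ _)⟩

lemma stripProj_of_abs_im_le {b : ℝ} {z : ℂ} (hz : |z.im| ≤ b) : stripProj b z = z := by
  rw [abs_le] at hz
  have : max (-b) (min b z.im) = z.im := by rw [min_eq_right hz.2, max_eq_right hz.1]
  simp only [stripProj, ContinuousMap.coe_mk, this, Complex.re_add_im]

/-- The projection commutes with real translations, so it maps the segment α + [0, 1] to the segment
starting at the projected shift. Composing Γ with it gives a problem for every complex α that
inherits uniform bounds from the closed strip and is unchanged inside it. -/
lemma shiftedOp_comp_stripProj (b : ℝ) (α : ℂ) :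
    shiftedOp hF B (Γ.comp (stripProj b)) α = shiftedOp hF B Γ (stripProj b α) := by
  have h1 : curveSegment (curveLinearization hF (Γ.comp (stripProj b))) α =
      curveSegment (curveLinearization hF Γ) (stripProj b α) := by
    ext1 t
    simp only [curveSegment, curveLinearization, ContinuousMap.coe_mk, ContinuousMap.comp_apply,
      stripProj_add_ofReal]
  have h2 : curveSegment (curveSection hF B (Γ.comp (stripProj b))) α =
      curveSegment (curveSection hF B Γ) (stripProj b α) := by
    ext1 t
    simp only [curveSegment, curveSection, ContinuousMap.coe_mk, ContinuousMap.comp_apply,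
      stripProj_add_ofReal]
  rw [shiftedOp, shiftedOp, h1, h2]

/-- Every point of a strip can be moved to a compact rectangle by an integer translation. -/
lemma exists_bound_of_periodic_strip {β : Type*} [SeminormedAddCommGroup β] {k : ℂ → β} {b : ℝ}
    (hk : ContinuousOn k {z | |z.im| ≤ b}) (hper : ∀ z, k (z + 1) = k z) :
    ∃ M, ∀ z : ℂ, |z.im| ≤ b → ‖k z‖ ≤ M := by
  have hK : IsCompact (Icc (0 : ℝ) 1 ×ℂ Icc (-b) b) := isCompact_Icc.reProdIm isCompact_Icc
  obtain ⟨M, hM⟩ := hK.exists_bound_of_continuousOn (f := k) (hk.mono fun z hz => by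
    have := (Complex.mem_reProdIm.1 hz).2
    exact abs_le.2 this)
  refine ⟨M, fun z hz => ?_⟩
  have hp : Function.Periodic k 1 := hper
  have h1 := hp.sub_int_mul_eq (x := z) ⌊z.re⌋
  rw [← h1]
  refine hM _ (Complex.mem_reProdIm.2 ⟨?_, ?_⟩)
  · have : (z - (⌊z.re⌋ : ℂ) * 1).re = Int.fract z.re := by
      simp
    rw [this]
    exact ⟨Int.fract_nonneg _, (Int.fract_lt_one _).le⟩
  · have : (z - (⌊z.re⌋ : ℂ) * 1).im = z.im := by simp
    rw [this]
    exact abs_le.1 hz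

lemma shiftedOp_add_one (hΓ : ∀ z, Γ (z + 1) = Γ z) (α : ℂ) :
    shiftedOp hF B Γ (α + 1) = shiftedOp hF B Γ α := by
  have e : ∀ t : I, Γ (α + 1 + ((t : ℝ) : ℂ)) = Γ (α + ((t : ℝ) : ℂ)) := fun t => by
    rw [← hΓ (α + _)]; congr 1; ring
  have h1 : curveSegment (curveLinearization hF Γ) (α + 1) =
      curveSegment (curveLinearization hF Γ) α := by
    ext1 t
    simp only [curveSegment, curveLinearization, ContinuousMap.coe_mk, e]
  have h2 : curveSegment (curveSection hF B Γ) (α + 1) = curveSegment (curveSection hF B Γ) α := by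
    ext1 t
    simp only [curveSegment, curveSection, ContinuousMap.coe_mk, e]
  rw [shiftedOp, shiftedOp, h1, h2]

/-- The operators at the shifts in a closed strip have uniformly bounded inverses. -/
theorem exists_bound_inverse_shiftedOp [CompleteSpace E] (hΓ : ∀ z, Γ (z + 1) = Γ z) {b : ℝ}
    (hu : ∀ α : ℂ, |α.im| ≤ b → IsUnit (shiftedOp hF B Γ α)) :
    ∃ M, ∀ α : ℂ, |α.im| ≤ b → ‖Ring.inverse (shiftedOp hF B Γ α)‖ ≤ M := by
  refine exists_bound_of_periodic_strip (k := fun α => Ring.inverse (shiftedOp hF B Γ α))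
    (fun α hα => ?_) fun α => by rw [shiftedOp_add_one hΓ]
  obtain ⟨w, hw⟩ := hu α hα
  have := NormedRing.inverse_continuousAt w
  rw [hw] at this
  exact (this.comp (continuous_shiftedOp hF B Γ).continuousAt).continuousWithinAt

end ShiftedInvertibility

/-! ### Real and complex vectors -/

section RealVectors

variable {N : ℕ}

lemma continuous_toComplexVec : Continuous (toComplexVec : (Fin N → ℝ) → Fin N → ℂ) :=
  continuous_pi fun i => Complex.continuous_ofReal.comp (continuous_apply i)

lemma norm_toComplexVec (x : Fin N → ℝ) : ‖toComplexVec x‖ = ‖x‖ := by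
  simp [toComplexVec, Pi.norm_def]

lemma toComplexVec_sub (x y : Fin N → ℝ) :
    toComplexVec (x - y) = toComplexVec x - toComplexVec y := by
  ext i; simp [toComplexVec]

lemma toComplexVec_add (x y : Fin N → ℝ) :
    toComplexVec (x + y) = toComplexVec x + toComplexVec y := by
  ext i; simp [toComplexVec]

lemma toComplexVec_injective : Function.Injective (toComplexVec : (Fin N → ℝ) → Fin N → ℂ) :=
  fun _ _ h => funext fun i => Complex.ofReal_injective (congrFun h i)

lemma IsRealVec.eq_toComplexVec {v : Fin N → ℂ} (hv : IsRealVec v) :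
    v = toComplexVec fun i => (v i).re :=
  funext fun i => Complex.ext rfl (by simpa [toComplexVec] using hv i)

lemma hasDerivAt_toComplexVec {z : ℝ → Fin N → ℝ} {w : Fin N → ℝ} {τ : ℝ}
    (hz : HasDerivAt z w τ) : HasDerivAt (fun s => toComplexVec (z s)) (toComplexVec w) τ := by
  rw [hasDerivAt_pi] at hz ⊢
  exact fun i => (hz i).ofReal_comp

/-- The derivative of a curve of real vectors is real. -/
lemma hasDerivAt_of_toComplexVec {z : ℝ → Fin N → ℝ} {v : Fin N → ℂ} {τ : ℝ}
    (hz : HasDerivAt (fun s => toComplexVec (z s)) v τ) :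
    IsRealVec v ∧ HasDerivAt z (fun i => (v i).re) τ := by
  rw [hasDerivAt_pi] at hz
  refine ⟨fun i => ?_, hasDerivAt_pi.2 fun i => ?_⟩
  · have h1 := Complex.imCLM.hasFDerivAt.comp_hasDerivAt τ (hz i)
    have h2 : (Complex.imCLM ∘ fun s => toComplexVec (z s) i) = fun _ => 0 := by
      funext s; simp [toComplexVec]
    rw [h2] at h1
    exact (h1.unique (hasDerivAt_const τ 0))
  · exact Complex.reCLM.hasFDerivAt.comp_hasDerivAt τ (hz i)

/-- The bilinear product `xᵀ y` on `ℂ^N`. -/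
noncomputable def dotCLM (N : ℕ) : (Fin N → ℂ) →L[ℂ] (Fin N → ℂ) →L[ℂ] ℂ :=
  ∑ i, (ContinuousLinearMap.proj i : (Fin N → ℂ) →L[ℂ] ℂ).smulRight
    (ContinuousLinearMap.proj i : (Fin N → ℂ) →L[ℂ] ℂ)

lemma dotCLM_apply (x y : Fin N → ℂ) : dotCLM N x y = ∑ i, x i * y i := by
  simp [dotCLM]

lemma dotCLM_toComplexVec (x y : Fin N → ℝ) :
    dotCLM N (toComplexVec x) (toComplexVec y) = ((∑ i, y i * x i : ℝ) : ℂ) := by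
  simp [dotCLM_apply, toComplexVec, mul_comm]

end RealVectors

/-! ### The linearization at the periodic orbit -/

section Orbit

variable {N : ℕ} {f : ℂ → (Fin N → ℂ) → Fin N → ℂ} {γ : ℝ → Fin N → ℝ}

/-- A family of vector fields as a map of pairs. -/
def pairedField (f : ℂ → (Fin N → ℂ) → Fin N → ℂ) (x : ℂ × (Fin N → ℂ)) : Fin N → ℂ := f x.1 x.2

lemma fderiv_pairedField (hf : Differentiable ℂ (pairedField f)) (x v : Fin N → ℂ) (μ : ℂ) :
    fderiv ℂ (pairedField f) (0, x) (μ, v) =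
      fderiv ℂ (f 0) x v + μ • deriv (fun μ : ℂ => f μ x) 0 := by
  have h1 : HasFDerivAt (f 0) ((fderiv ℂ (pairedField f) (0, x)).comp
      (ContinuousLinearMap.inr ℂ ℂ (Fin N → ℂ))) x :=
    (hf (0, x)).hasFDerivAt.comp x (hasFDerivAt_prodMk_right (0 : ℂ) x)
  have h2 : HasDerivAt (fun μ : ℂ => f μ x) (fderiv ℂ (pairedField f) (0, x) (1, 0)) 0 := by
    have := (hf (id (0 : ℂ), x)).hasFDerivAt.comp_hasDerivAt (0 : ℂ)
      ((hasDerivAt_id (0 : ℂ)).prodMk (hasDerivAt_const (0 : ℂ) x))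
    exact this
  rw [h1.fderiv, h2.deriv, ContinuousLinearMap.comp_apply, ContinuousLinearMap.inr_apply,
    ← map_smul, ← map_add]
  congr 1
  ext <;> simp

lemma IsPeriodicOrbit.hasDerivAt (hγ : IsPeriodicOrbit f γ) (τ : ℝ) :
    HasDerivAt γ (deriv γ τ) τ :=
  (hasDerivAt_of_toComplexVec (hγ.1 τ)).2.differentiableAt.hasDerivAt

lemma IsPeriodicOrbit.field_eq (hγ : IsPeriodicOrbit f γ) (τ : ℝ) :
    f 0 (toComplexVec (γ τ)) = toComplexVec (deriv γ τ) :=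
  (hγ.1 τ).unique (hasDerivAt_toComplexVec (hγ.hasDerivAt τ))

lemma IsPeriodicOrbit.continuous (hγ : IsPeriodicOrbit f γ) : Continuous γ :=
  continuous_iff_continuousAt.2 fun τ => (hγ.hasDerivAt τ).continuousAt

/-- A constant γ would have period 1/2, against minimality of the period 1. -/
lemma IsPeriodicOrbit.deriv_not_identically_zero (hγ : IsPeriodicOrbit f γ)
    (h : ∀ τ, deriv γ τ = 0) : False := by
  have hc := is_const_of_deriv_eq_zero (f := γ)
    (fun τ => (hγ.hasDerivAt τ).differentiableAt) h
  exact hγ.2.2 (1 / 2) (by norm_num) (by norm_num) fun τ => hc _ _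

variable {Γ : C(ℂ, Fin N → ℂ)}

/-- Solutions of the linearized equation which vanish at `0` vanish on `[0, 1]`. -/
lemma eq_zero_of_linearized (hf : Differentiable ℂ (pairedField f))
    (hΓγ : ∀ τ : ℝ, Γ τ = toComplexVec (γ τ))
    {w : ℝ → Fin N → ℂ} (hw : ∀ t, HasDerivAt w (floquetLinearization f γ t (w t)) t)
    (h0 : w 0 = 0) (t : I) : w t = 0 := by
  have hwc : Continuous w := continuous_iff_continuousAt.2 fun t => (hw t).continuousAt
  set P := curveSegment (curveLinearization hf Γ) 0 with hP
  have hPa : ∀ s : I, ∀ v, P s (0, v) = floquetLinearization f γ s v := by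
    intro s v
    have : P s (0, v) = fderiv ℂ (pairedField f) (0, Γ (0 + ((s : ℝ) : ℂ))) (0, v) := rfl
    rw [this, zero_add, hΓγ, fderiv_pairedField hf, zero_smul, add_zero]
    rfl
  let W : C(I, Fin N → ℂ) := ⟨fun t => w t, by fun_prop⟩
  -- Uniqueness for the initial value problem comes from injectivity of 1 - V: a solution with zero
  -- initial value lies in its kernel.
  have h1 : (1 - volterraOp P) (0, W) = 0 := by
    refine Prod.ext ?_ (ContinuousMap.ext fun t => ?_)
    · change (0 : ℂ) - 0 = 0
      simp
    · change w t - (volterraOp P (0, W)).2 t = 0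
      have hci : Continuous (IccExtend zero_le_one fun s : I => P s ((0 : ℂ), W s)) :=
        Continuous.Icc_extend' (P.continuous.clm_apply (by fun_prop))
      have h2 := intervalIntegral.integral_eq_sub_of_hasDerivAt (f := w)
        (f' := IccExtend zero_le_one fun s : I => P s ((0 : ℂ), W s)) (a := 0) (b := t)
        (fun s hs => by
          rw [uIcc_of_le t.2.1] at hs
          rw [IccExtend_of_mem _ _ ⟨hs.1, hs.2.trans t.2.2⟩, hPa]
          exact hw s) (hci.intervalIntegrable _ _)
      rw [volterraOp_snd, h2, h0]
      simp
  have h3 := ring_inverse_apply' (isUnit_one_sub_volterraOp P) ((0 : ℂ), W)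
  rw [h1, map_zero] at h3
  exact (DFunLike.congr_fun (congrArg Prod.snd h3) t).symm

/-- Hyperbolicity and transversality make the boundary value problem at the real orbit
nondegenerate. -/
theorem shiftedOp_zero_injective (hf : Differentiable ℂ (pairedField f)) (hγ : IsPeriodicOrbit f γ) (hhyp : IsHyperbolicOrbit f γ)
    (htrans : IsParameterTransverse f γ) (hΓ : ∀ z, Γ (z + 1) = Γ z)
    (hΓγ : ∀ τ : ℝ, Γ τ = toComplexVec (γ τ)) (u : ℂ × C(I, Fin N → ℂ))
    (hu : shiftedOp hf (dotCLM N) Γ 0 u = 0) : u = 0 := by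
  obtain ⟨z, hz1, hz2, hz3, hz4⟩ := (shiftedOp_eq_zero_iff hΓ 0 u).1 hu
  have hz3' : ∀ t : ℝ, HasDerivAt z (floquetLinearization f γ t (z t) +
      u.1 • deriv (fun μ : ℂ => f μ (toComplexVec (γ t))) 0) t := by
    intro t
    have := hz3 t
    rw [zero_add, hΓγ, fderiv_pairedField hf] at this
    exact this
  -- Otherwise z/μ would be a periodic solution of the equation excluded by transversality.
  have hμ : u.1 = 0 := by
    by_contra hne
    refine htrans ⟨fun t => u.1⁻¹ • z t, fun t => by simp only [hz1 t], fun t => ?_⟩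
    have := (hz3' t).const_smul u.1⁻¹
    rw [smul_add, inv_smul_smul₀ hne, ← map_smul] at this
    exact this
  have hzlin : ∀ t : ℝ, HasDerivAt z (floquetLinearization f γ t (z t)) t := by
    intro t
    have := hz3' t
    rwa [hμ, zero_smul, add_zero] at this
  -- The velocity e = γ' solves the linearized equation. It does not vanish at 0, since otherwise it
  -- would vanish identically.
  set e : ℝ → Fin N → ℂ := fun t => f 0 (toComplexVec (γ t)) with he
  have hf0 : Differentiable ℂ (f 0) := hf.comp (f := fun x => ((0 : ℂ), x)) (by fun_prop)
  have helin : ∀ t, HasDerivAt e (floquetLinearization f γ t (e t)) t := by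
    intro t
    have := ((hf0 (toComplexVec (γ t))).hasFDerivAt.restrictScalars ℝ).comp_hasDerivAt t (hγ.1 t)
    exact this
  have hep : Function.Periodic e 1 := fun t => by simp only [he, hγ.2.1 t]
  have hereal : ∀ t, e t = toComplexVec (deriv γ t) := hγ.field_eq
  have hec : Continuous e := continuous_iff_continuousAt.2 fun t => (helin t).continuousAt
  have he0 : e 0 ≠ 0 := by
    intro h0
    refine hγ.deriv_not_identically_zero fun τ => toComplexVec_injective ?_
    have h1 := eq_zero_of_linearized hf hΓγ helin h0
    have h2 : e = fun _ => 0 := hep.ext_unitInterval (fun _ => rfl) h1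
    rw [← hereal, h2]
    ext i
    simp [toComplexVec]
  obtain ⟨Φ, hΦ0, hΦ, hroot⟩ := hhyp
  have hflow : ∀ w : ℝ → Fin N → ℂ, (∀ t, HasDerivAt w (floquetLinearization f γ t (w t)) t) →
      Function.Periodic w 1 → w 0 ∈ Module.End.eigenspace
        ((Φ 1 : (Fin N → ℂ) →L[ℂ] (Fin N → ℂ)) : Module.End ℂ (Fin N → ℂ)) 1 := by
    intro w hw hwp
    rw [Module.End.mem_eigenspace_iff, one_smul]
    have h1 := eq_zero_of_linearized hf hΓγ (w := fun t => Φ t (w 0) - w t) (fun t => by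
      rw [map_sub]
      refine HasDerivAt.sub ?_ (hw t)
      have h2 := (ContinuousLinearMap.apply ℂ (Fin N → ℂ) (w 0)).hasFDerivAt.restrictScalars ℝ
        |>.comp_hasDerivAt t (hΦ t)
      exact h2) (by simp [hΦ0]) 1
    have h3 : w 1 = w 0 := by simpa using hwp 0
    have h4 : Φ 1 (w 0) - w 1 = 0 := h1
    rw [h3, sub_eq_zero] at h4
    exact h4
  -- Initial values of periodic solutions are fixed by Φ(1), and the eigenspace of 1 has dimension
  -- at most the root multiplicity 1. So z(0) is a multiple of γ'(0).
  obtain ⟨c, hc⟩ : ∃ c : ℂ, c • e 0 = z 0 := by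
    have h1 := LinearMap.finrank_eigenspace_le
      ((Φ 1 : (Fin N → ℂ) →L[ℂ] (Fin N → ℂ)) : Module.End ℂ (Fin N → ℂ)) 1
    rw [hroot] at h1
    obtain ⟨v, hv⟩ := finrank_le_one_iff.1 h1
    obtain ⟨a, ha⟩ := hv ⟨e 0, hflow e helin hep⟩
    obtain ⟨b, hb⟩ := hv ⟨z 0, hflow z hzlin hz1⟩
    have ha' : a • (v : Fin N → ℂ) = e 0 := congrArg Subtype.val ha
    have hb' : b • (v : Fin N → ℂ) = z 0 := congrArg Subtype.val hb
    have ha0 : a ≠ 0 := by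
      rintro rfl
      rw [zero_smul] at ha'
      exact he0 ha'.symm
    exact ⟨b * a⁻¹, by rw [← ha', ← hb', smul_smul, inv_mul_cancel_right₀ ha0]⟩
  have hzc : ∀ t : I, z t = c • e t := by
    intro t
    have := eq_zero_of_linearized hf hΓγ (w := fun t => z t - c • e t) (fun t => by
      rw [map_sub, map_smul]
      exact (hzlin t).sub ((helin t).const_smul c)) (by simp [hc]) t
    exact sub_eq_zero.1 this
  -- With z = c γ', the phase condition reads c ∫ |γ'|² = 0. This removes the translation direction.
  have hint : c * ((∫ s in (0 : ℝ)..1, ∑ i, deriv γ s i * deriv γ s i : ℝ) : ℂ) = 0 := by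
    rw [← hz4, ← intervalIntegral.integral_ofReal, ← intervalIntegral.integral_const_mul]
    refine intervalIntegral.integral_congr fun s hs => ?_
    rw [uIcc_of_le zero_le_one] at hs
    rw [hzc ⟨s, hs⟩, zero_add, hΓγ, map_smul, smul_eq_mul]
    congr 1
    rw [← dotCLM_toComplexVec, ← hereal]
    rfl
  have hpos : 0 < ∫ s in (0 : ℝ)..1, ∑ i, deriv γ s i * deriv γ s i := by
    have hdc : Continuous (deriv γ) := by
      have : deriv γ = fun t i => (e t i).re := by
        funext t i
        simp [hereal, toComplexVec]
      rw [this]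
      exact continuous_pi fun i => Complex.continuous_re.comp ((continuous_apply i).comp hec)
    refine intervalIntegral.integral_pos one_pos (Continuous.continuousOn ?_)
      (fun s _ => Finset.sum_nonneg fun i _ => mul_self_nonneg _) ⟨0, ⟨le_rfl, zero_le_one⟩, ?_⟩
    · exact continuous_finsetSum _ fun i _ => ((continuous_apply i).comp hdc).mul
        ((continuous_apply i).comp hdc)
    · have hd0 : deriv γ 0 ≠ 0 := by
        intro h
        apply he0
        rw [hereal, h]
        ext i
        simp [toComplexVec]
      obtain ⟨i, hi⟩ := Function.ne_iff.1 hd0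
      exact Finset.sum_pos' (fun i _ => mul_self_nonneg _) ⟨i, Finset.mem_univ _,
        mul_self_pos.2 hi⟩
  have hc0 : c = 0 := (mul_eq_zero.1 hint).resolve_right (by exact_mod_cast hpos.ne')
  refine Prod.ext hμ (ContinuousMap.ext fun t => ?_)
  rw [← hz2, hzc, hc0, zero_smul]
  rfl

end Orbit

/-! ### The rapidly oscillating forcing -/

section Forcing

variable {N : ℕ} {g : ℂ → ℂ → ℝ → (Fin N → ℂ) → Fin N → ℂ}

/-- The forcing term `ε^p g(μ, ε, t/ε, z)` with `ε = 1/n`. -/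
noncomputable def rapidForcing (g : ℂ → ℂ → ℝ → (Fin N → ℂ) → Fin N → ℂ) (p n : ℕ) (t : ℝ)
    (x : ℂ × (Fin N → ℂ)) : Fin N → ℂ :=
  ((1 / (n : ℝ) : ℝ) : ℂ) ^ p • g x.1 ((1 / (n : ℝ) : ℝ) : ℂ) (t / (1 / (n : ℝ))) x.2

lemma continuous_rapidForcing (hg : IsRealEntireForcing g) (p n : ℕ) :
    Continuous (Function.uncurry (rapidForcing g p n)) := by
  have h : Continuous fun x : ℝ × ℂ × (Fin N → ℂ) =>
      g x.2.1 ((1 / (n : ℝ) : ℝ) : ℂ) (x.1 / (1 / (n : ℝ))) x.2.2 :=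
    hg.1.comp (f := fun x : ℝ × ℂ × (Fin N → ℂ) =>
      (x.2.1, ((1 / (n : ℝ) : ℝ) : ℂ), x.1 / (1 / (n : ℝ)), x.2.2))
      (by simp only [div_eq_mul_inv]; fun_prop)
  exact h.const_smul (((1 / (n : ℝ) : ℝ) : ℂ) ^ p)

lemma differentiable_rapidForcing (hg : IsRealEntireForcing g) (p n : ℕ) (t : ℝ) :
    Differentiable ℂ (rapidForcing g p n t) := by
  have h : Differentiable ℂ fun x : ℂ × (Fin N → ℂ) =>
      g x.1 ((1 / (n : ℝ) : ℝ) : ℂ) (t / (1 / (n : ℝ))) x.2 :=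
    (hg.2.1 (t / (1 / (n : ℝ)))).comp (f := fun x : ℂ × (Fin N → ℂ) =>
      (x.1, ((1 / (n : ℝ) : ℝ) : ℂ), x.2)) (by fun_prop)
  exact h.const_smul (((1 / (n : ℝ) : ℝ) : ℂ) ^ p)

/-- Since 1/ε = n is an integer, a unit of time is exactly n periods of the fast phase. -/
lemma rapidForcing_add_one (hg : IsRealEntireForcing g) (p n : ℕ) (t : ℝ)
    (x : ℂ × (Fin N → ℂ)) : rapidForcing g p n (t + 1) x = rapidForcing g p n t x := by
  have h : Function.Periodic (fun β => g x.1 ((1 / (n : ℝ) : ℝ) : ℂ) β x.2) 1 :=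
    fun β => hg.2.2.1 _ _ β _
  have h1 := h.nat_mul n (t / (1 / (n : ℝ)))
  have e : t / (1 / (n : ℝ)) + n * 1 = (t + 1) / (1 / (n : ℝ)) := by
    simp only [one_div, div_inv_eq_mul]; ring
  simp only [e] at h1
  rw [rapidForcing, rapidForcing, h1]

/-- Periodicity in β reduces the fast phase, unbounded as n grows, to [0, 1], so compactness gives a
bound on g uniform in n and t. The factor ε^p ≤ ε supplies the decay, by p ≥ 1. -/
lemma exists_bound_rapidForcing (hg : IsRealEntireForcing g) {p : ℕ} (hp : 1 ≤ p) (ρ : ℝ) :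
    ∃ K, ∀ n t x, 1 ≤ n → ‖x‖ ≤ ρ → ‖rapidForcing g p n t x‖ ≤ K / n := by
  have hK : IsCompact (closedBall (0 : ℂ) ρ ×ˢ closedBall (0 : ℂ) 1 ×ˢ Icc (0 : ℝ) 1 ×ˢ
      closedBall (0 : Fin N → ℂ) ρ) :=
    (isCompact_closedBall _ _).prod ((isCompact_closedBall _ _).prod
      (isCompact_Icc.prod (isCompact_closedBall _ _)))
  obtain ⟨K, hKb⟩ := hK.exists_bound_of_continuousOn hg.1.continuousOn
  refine ⟨K, fun n t x hn hx => ?_⟩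
  have hn0 : (0 : ℝ) < n := by exact_mod_cast hn
  have hn1 : (1 : ℝ) ≤ n := by exact_mod_cast hn
  have hε : ‖((1 / (n : ℝ) : ℝ) : ℂ)‖ = 1 / n := by
    rw [Complex.norm_real, Real.norm_of_nonneg (by positivity)]
  have hε1 : 1 / (n : ℝ) ≤ 1 := by rw [div_le_one hn0]; exact hn1
  have h : Function.Periodic (fun β => g x.1 ((1 / (n : ℝ) : ℝ) : ℂ) β x.2) 1 :=
    fun β => hg.2.2.1 _ _ β _
  set β := t / (1 / (n : ℝ))
  have h1 := h.sub_int_mul_eq (x := β) ⌊β⌋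
  simp only [mul_one, Int.self_sub_floor] at h1
  have h2 := hKb (x.1, ((1 / (n : ℝ) : ℝ) : ℂ), Int.fract β, x.2)
    ⟨mem_closedBall_zero_iff.2 ((norm_fst_le x).trans hx),
      mem_closedBall_zero_iff.2 (hε.trans_le hε1),
      ⟨Int.fract_nonneg _, (Int.fract_lt_one _).le⟩,
      mem_closedBall_zero_iff.2 ((norm_snd_le x).trans hx)⟩
  simp only [h1] at h2
  rw [rapidForcing, norm_smul, norm_pow, hε]
  calc (1 / (n : ℝ)) ^ p * _ ≤ (1 / (n : ℝ)) ^ 1 * K := by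
        refine mul_le_mul (pow_le_pow_of_le_one (by positivity) hε1 hp) h2 (norm_nonneg _)
          (by positivity)
    _ = K / n := by rw [pow_one]; ring

end Forcing

/-! ### Reality of the solutions at real shifts -/

section Reality

variable {N : ℕ} {f : ℂ → (Fin N → ℂ) → Fin N → ℂ}
  {g : ℂ → ℂ → ℝ → (Fin N → ℂ) → Fin N → ℂ} {Γ : C(ℂ, Fin N → ℂ)} {γ : ℝ → Fin N → ℝ}

lemma isRealVec_iff_star_eq {v : Fin N → ℂ} : IsRealVec v ↔ star v = v := by
  rw [funext_iff]
  exact forall_congr' fun i => Complex.conj_eq_iff_im.symm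

lemma star_primitiveCLM (h : C(I, Fin N → ℂ)) :
    star (primitiveCLM (Fin N → ℂ) h) = primitiveCLM (Fin N → ℂ) (star h) := by
  ext1 t
  have h1 := (starL' ℝ : (Fin N → ℂ) ≃L[ℝ] (Fin N → ℂ)).toContinuousLinearMap
    |>.intervalIntegral_comp_comm (μ := MeasureTheory.volume) (a := 0) (b := t)
    ((h.continuous.Icc_extend' (h := zero_le_one)).intervalIntegrable 0 t)
  exact h1.symm

/-- At real points the derivative of a real field commutes with conjugation. -/
lemma star_fderiv_pairedField (hf : IsRealEntireField f) (x : Fin N → ℝ)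
    (w : ℂ × (Fin N → ℂ)) :
    fderiv ℂ (pairedField f) (0, toComplexVec x) (star w) =
      star (fderiv ℂ (pairedField f) (0, toComplexVec x) w) := by
  set L := fderiv ℂ (pairedField f) (0, toComplexVec x) with hL
  have hreal : ∀ (μ : ℝ) (v : Fin N → ℝ), star (L ((μ : ℂ), toComplexVec v)) =
      L ((μ : ℂ), toComplexVec v) := by
    intro μ v
    rw [← isRealVec_iff_star_eq]
    -- The field is real along this curve of real points, hence so is its derivative at s = 0, which
    -- is the value of L in the real direction (μ, v).
    have h0 : HasDerivAt (fun s : ℝ => ((s : ℂ) * (μ : ℂ), toComplexVec (x + s • v)))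
        ((μ : ℂ), toComplexVec v) 0 := by
      refine HasDerivAt.prodMk ?_ (hasDerivAt_toComplexVec ?_)
      · simpa using (hasDerivAt_id (0 : ℝ)).ofReal_comp.mul_const (μ : ℂ)
      · simpa using ((hasDerivAt_id (0 : ℝ)).smul_const v).const_add x
    have hF : HasFDerivAt (pairedField f) (L.restrictScalars ℝ)
        (((0 : ℝ) : ℂ) * (μ : ℂ), toComplexVec (x + (0 : ℝ) • v)) := by
      have e : (((0 : ℝ) : ℂ) * (μ : ℂ), toComplexVec (x + (0 : ℝ) • v)) = (0, toComplexVec x) := by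
        simp
      rw [e]
      have hF' : Differentiable ℂ (pairedField f) := hf.1
      exact (hF' (0, toComplexVec x)).hasFDerivAt.restrictScalars ℝ
    have h1 := hF.comp_hasDerivAt (0 : ℝ) h0
    have h2 : (pairedField f ∘ fun s : ℝ => ((s : ℂ) * (μ : ℂ), toComplexVec (x + s • v))) =
        fun s : ℝ => toComplexVec fun i => (f ((s * μ : ℝ) : ℂ) (toComplexVec (x + s • v)) i).re := by
      funext s
      rw [← (hf.2 (s * μ) (x + s • v)).eq_toComplexVec]
      simp [pairedField]
    rw [h2] at h1
    exact (hasDerivAt_of_toComplexVec h1).1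
  have hdec : ∀ w : ℂ × (Fin N → ℂ), w = ((w.1.re : ℂ), toComplexVec fun i => (w.2 i).re) +
      Complex.I • ((w.1.im : ℂ), toComplexVec fun i => (w.2 i).im) := by
    intro w
    ext i
    · simp [mul_comm Complex.I, Complex.re_add_im]
    · simp [toComplexVec, mul_comm Complex.I, Complex.re_add_im]
  have hsdec : star w = ((w.1.re : ℂ), toComplexVec fun i => (w.2 i).re) -
      Complex.I • ((w.1.im : ℂ), toComplexVec fun i => (w.2 i).im) := by
    rw [hdec (star w), sub_eq_add_neg, ← smul_neg]
    congr 1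
    ext i <;> simp [toComplexVec]
  rw [hsdec, map_sub, map_smul]
  conv_rhs => rw [hdec w, map_add, map_smul, star_add, star_smul, hreal, hreal]
  rw [sub_eq_add_neg, ← neg_smul]
  simp

lemma star_shiftedOp (hf : IsRealEntireField f) (hΓγ : ∀ s : ℝ, Γ s = toComplexVec (γ s))
    (hF : Differentiable ℂ (pairedField f)) (α : ℝ) (u : ℂ × C(I, Fin N → ℂ)) :
    shiftedOp hF (dotCLM N) Γ α (star u) = star (shiftedOp hF (dotCLM N) Γ α u) := by
  have hΓ' : ∀ s : I, Γ ((α : ℂ) + ((s : ℝ) : ℂ)) = toComplexVec (γ (α + s)) := fun s => by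
    rw [← hΓγ]; push_cast; rfl
  refine Prod.ext ?_ (ContinuousMap.ext fun t => ?_)
  · have h1 := (starL' ℝ : ℂ ≃L[ℝ] ℂ).toContinuousLinearMap.intervalIntegral_comp_comm
      (μ := MeasureTheory.volume) (a := 0) (b := 1)
      ((((curveSegment (curveSection hF (dotCLM N) Γ) α).continuous.clm_apply
        u.2.continuous).Icc_extend' (h := zero_le_one)).intervalIntegrable 0 1)
    have h2 : (star (shiftedOp hF (dotCLM N) Γ α u)).1 =
        star (shiftedOp hF (dotCLM N) Γ α u).1 := rfl
    rw [h2, shiftedOp, boundaryOp_fst, boundaryOp_fst]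
    refine Eq.trans ?_ h1
    refine intervalIntegral.integral_congr fun s hs => ?_
    rw [uIcc_of_le zero_le_one] at hs
    change IccExtend _ _ s = star (IccExtend _ _ s)
    rw [IccExtend_of_mem _ _ hs, IccExtend_of_mem _ _ hs]
    change dotCLM N (pairedField f (0, Γ ((α : ℂ) + ((s : ℝ) : ℂ)))) (star (u.2 ⟨s, hs⟩)) =
      star (dotCLM N (pairedField f (0, Γ ((α : ℂ) + ((s : ℝ) : ℂ)))) (u.2 ⟨s, hs⟩))
    have h3 : star (pairedField f (0, Γ ((α : ℂ) + ((s : ℝ) : ℂ)))) =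
        pairedField f (0, Γ ((α : ℂ) + ((s : ℝ) : ℂ))) := by
      rw [← isRealVec_iff_star_eq, hΓ' ⟨s, hs⟩]
      exact hf.2 0 _
    conv_lhs => rw [← h3]
    simp [dotCLM_apply]
  · have h1 := DFunLike.congr_fun (star_primitiveCLM (N := N)
      ⟨fun s : I => curveSegment (curveLinearization hF Γ) α s (u.1, u.2 s),
        (curveSegment (curveLinearization hF Γ) α).continuous.clm_apply (by fun_prop)⟩) t
    have h2 : (star (shiftedOp hF (dotCLM N) Γ α u)).2 t =
        star ((shiftedOp hF (dotCLM N) Γ α u).2 t) := rfl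
    rw [h2, shiftedOp, boundaryOp_snd, boundaryOp_snd, star_sub, star_sub]
    congr 1
    refine Eq.trans ?_ h1.symm
    refine intervalIntegral.integral_congr fun s hs => ?_
    rw [uIcc_of_le t.2.1] at hs
    have hs' : s ∈ I := ⟨hs.1, hs.2.trans t.2.2⟩
    rw [IccExtend_of_mem _ _ hs', IccExtend_of_mem _ _ hs']
    change fderiv ℂ (pairedField f) (0, Γ ((α : ℂ) + ((s : ℝ) : ℂ))) (star (u.1, u.2 ⟨s, hs'⟩)) =
      star (fderiv ℂ (pairedField f) (0, Γ ((α : ℂ) + ((s : ℝ) : ℂ))) (u.1, u.2 ⟨s, hs'⟩))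
    rw [hΓ' ⟨s, hs'⟩, star_fderiv_pairedField hf]

/-- At real shifts the fixed point operator preserves real functions. -/
lemma mapsTo_fixedPointOp_star (hf : IsRealEntireField f) (hg : IsRealEntireForcing g)
    (hΓγ : ∀ s : ℝ, Γ s = toComplexVec (γ s)) (hF : Differentiable ℂ (pairedField f))
    {p n : ℕ} (hG : Continuous (Function.uncurry (rapidForcing g p n))) (α : ℝ)
    (hu : IsUnit (shiftedOp hF (dotCLM N) Γ α)) :
    MapsTo (fixedPointOp hF (dotCLM N) Γ hG α) {u | star u = u} {u | star u = u} := by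
  intro u hus
  change star u = u at hus
  have h1 : star u.1 = u.1 := congrArg Prod.fst hus
  have h2 : ∀ t, star (u.2 t) = u.2 t := fun t =>
    DFunLike.congr_fun (congrArg Prod.snd hus) t
  have hQ : star (nonlinearity hF Γ hG α u) = nonlinearity hF Γ hG α u := by
    ext1 t
    have hΓ' : Γ ((α : ℂ) + ((t : ℝ) : ℂ)) = toComplexVec (γ (α + t)) := by
      rw [← hΓγ]; push_cast; rfl
    have hμ : u.1 = ((u.1.re : ℝ) : ℂ) := (Complex.conj_eq_iff_re.1 h1).symm
    have hx : u.2 t = toComplexVec fun i => (u.2 t i).re :=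
      (isRealVec_iff_star_eq.2 (h2 t)).eq_toComplexVec
    have e1 : star (f u.1 (Γ ((α : ℂ) + ((t : ℝ) : ℂ)) + u.2 t)) =
        f u.1 (Γ ((α : ℂ) + ((t : ℝ) : ℂ)) + u.2 t) := by
      rw [← isRealVec_iff_star_eq, hΓ', hx, ← toComplexVec_add, hμ]
      exact hf.2 _ _
    have e2 : star (f 0 (Γ ((α : ℂ) + ((t : ℝ) : ℂ)))) = f 0 (Γ ((α : ℂ) + ((t : ℝ) : ℂ))) := by
      rw [← isRealVec_iff_star_eq, hΓ']
      exact hf.2 0 _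
    have e3 : star (fderiv ℂ (pairedField f) (0, Γ ((α : ℂ) + ((t : ℝ) : ℂ))) (u.1, u.2 t)) =
        fderiv ℂ (pairedField f) (0, Γ ((α : ℂ) + ((t : ℝ) : ℂ))) (u.1, u.2 t) := by
      rw [hΓ', ← star_fderiv_pairedField hf]
      congr 1
      exact Prod.ext h1 (h2 t)
    have e4 : star (rapidForcing g p n t (u.1, Γ ((α : ℂ) + ((t : ℝ) : ℂ)) + u.2 t)) =
        rapidForcing g p n t (u.1, Γ ((α : ℂ) + ((t : ℝ) : ℂ)) + u.2 t) := by
      rw [rapidForcing, star_smul, star_pow]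
      congr 1
      · congr 1
        exact Complex.conj_ofReal _
      · rw [← isRealVec_iff_star_eq]
        simp only []
        rw [hΓ', hx, ← toComplexVec_add, hμ]
        exact hg.2.2.2 _ _ _ _
    change star (f u.1 (Γ ((α : ℂ) + ((t : ℝ) : ℂ)) + u.2 t) -
      f 0 (Γ ((α : ℂ) + ((t : ℝ) : ℂ))) -
      fderiv ℂ (pairedField f) (0, Γ ((α : ℂ) + ((t : ℝ) : ℂ))) (u.1, u.2 t) +
      rapidForcing g p n t (u.1, Γ ((α : ℂ) + ((t : ℝ) : ℂ)) + u.2 t)) = _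
    rw [star_add, star_sub, star_sub, e1, e2, e3, e4]
    rfl
  change star (fixedPointOp hF (dotCLM N) Γ hG α u) = fixedPointOp hF (dotCLM N) Γ hG α u
  -- Conjugation commutes with the linear operator at a real shift, hence also with its inverse.
  rw [fixedPointOp, ← ring_inverse_apply' hu (star _), star_shiftedOp hf hΓγ,
    ring_inverse_apply hu]
  congr 1
  refine Prod.ext ?_ ?_
  · exact star_zero _
  · change star (primitiveCLM (Fin N → ℂ) _) = _
    rw [star_primitiveCLM, hQ]

end Reality

/-! ### Fixed points and periodic solutions -/

section FixedPoints

variable {E : Type*} [NormedAddCommGroup E] [NormedSpace ℂ E] [FiniteDimensional ℂ E]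
  {F : ℂ × E → E} {hF : Differentiable ℂ F} {B : E →L[ℂ] E →L[ℂ] ℂ}

/-- The operator sees the curve only on α + [0, 1]. This allows branches built from different
complex extensions of γ to be compared at real shifts. -/
lemma fixedPointOp_congr {Γ₁ Γ₂ : C(ℂ, E)} {G : ℝ → ℂ × E → E}
    (hG : Continuous (Function.uncurry G)) {α : ℂ}
    (h : ∀ t : I, Γ₁ (α + ((t : ℝ) : ℂ)) = Γ₂ (α + ((t : ℝ) : ℂ))) :
    fixedPointOp hF B Γ₁ hG α = fixedPointOp hF B Γ₂ hG α := by
  have h1 : curveSegment (curveLinearization hF Γ₁) α =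
      curveSegment (curveLinearization hF Γ₂) α := by
    ext1 t
    simp only [curveSegment, curveLinearization, ContinuousMap.coe_mk, h]
  have h2 : curveSegment (curveSection hF B Γ₁) α = curveSegment (curveSection hF B Γ₂) α := by
    ext1 t
    simp only [curveSegment, curveSection, ContinuousMap.coe_mk, h]
  funext u
  have h3 : nonlinearity hF Γ₁ hG α u = nonlinearity hF Γ₂ hG α u := by
    ext1 t
    simp only [nonlinearity, ContinuousMap.coe_mk, h]
  rw [fixedPointOp, fixedPointOp, shiftedOp, shiftedOp, h1, h2, h3]

/-- The right hand side of the equation for the deviation from the shifted curve. -/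
noncomputable def deviationField (F : ℂ × E → E) (Γ : C(ℂ, E)) (G : ℝ → ℂ × E → E) (α μ : ℂ) (t : ℝ) (x : E) :
    E :=
  F (μ, Γ (α + t) + x) - F (0, Γ (α + t)) + G t (μ, Γ (α + t) + x)

theorem fixedPointOp_eq_self_iff [CompleteSpace E] {Γ : C(ℂ, E)} (hΓ : ∀ z, Γ (z + 1) = Γ z)
    {G : ℝ → ℂ × E → E} (hG : Continuous (Function.uncurry G))
    (hGper : ∀ t x, G (t + 1) x = G t x) {α : ℂ} (hu : IsUnit (shiftedOp hF B Γ α))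
    (u : ℂ × C(I, E)) :
    fixedPointOp hF B Γ hG α u = u ↔ ∃ z : ℝ → E, Function.Periodic z 1 ∧ (∀ t : I, z t = u.2 t) ∧
      (∀ t, HasDerivAt z (deviationField F Γ G α u.1 t (z t)) t) ∧
      ∫ s in (0 : ℝ)..1, B (F (0, Γ (α + s))) (z s) = 0 := by
  rw [fixedPointOp_eq_iff hG hu]
  refine shiftedOp_eq_iff α u ?_ ?_ ?_
  · have h1 := hF.continuous
    have hc : Continuous fun q : ℝ × E => Γ (α + q.1) := by fun_prop
    have e1 : Continuous fun q : ℝ × E => F (u.1, Γ (α + q.1) + q.2) := by fun_prop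
    have e2 : Continuous fun q : ℝ × E => F (0, Γ (α + q.1)) := by fun_prop
    have e3 : Continuous fun q : ℝ × E => G q.1 (u.1, Γ (α + q.1) + q.2) :=
      hG.comp (f := fun q : ℝ × E => (q.1, (u.1, Γ (α + q.1) + q.2))) (by fun_prop)
    exact (e1.sub e2).add e3
  · intro t x
    have : Γ (α + ((t + 1 : ℝ) : ℂ)) = Γ (α + t) := by
      rw [← hΓ (α + t)]; push_cast; rw [add_assoc]
    simp only [deviationField, hGper, this]
  · intro s
    simp only [deviationField, nonlinearity, ContinuousMap.coe_mk]
    abel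

end FixedPoints

/-! ### Local solutions of the forced problem -/

section LocalSolutions

variable {N : ℕ} {f : ℂ → (Fin N → ℂ) → Fin N → ℂ}
  {g : ℂ → ℂ → ℝ → (Fin N → ℂ) → Fin N → ℂ} {γ : ℝ → Fin N → ℝ} {Γ : C(ℂ, Fin N → ℂ)} {p n : ℕ}

/-- The deviation of a curve from the shifted periodic orbit. -/
def deviation (γ z : ℝ → Fin N → ℝ) (α : ℝ) (t : ℝ) : Fin N → ℂ :=
  toComplexVec (z t - γ (t + α))

lemma add_deviation (hΓγ : ∀ s : ℝ, Γ s = toComplexVec (γ s)) (z : ℝ → Fin N → ℝ) (α t : ℝ) :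
    Γ ((α : ℂ) + t) + deviation γ z α t = toComplexVec (z t) := by
  have : (α : ℂ) + t = ((t + α : ℝ) : ℂ) := by push_cast; ring
  rw [this, hΓγ, deviation, toComplexVec_sub]
  abel

lemma isForcedPeriodicSolution_iff (hγ : IsPeriodicOrbit f γ)
    (hΓγ : ∀ s : ℝ, Γ s = toComplexVec (γ s)) (α μ : ℝ) (z : ℝ → Fin N → ℝ) :
    IsForcedPeriodicSolution f g p (1 / (n : ℝ)) μ z ↔ Function.Periodic (deviation γ z α) 1 ∧
      ∀ t, HasDerivAt (deviation γ z α) (deviationField (pairedField f) Γ (rapidForcing g p n) α μ t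
        (deviation γ z α t)) t := by
  have hγα : ∀ t : ℝ, γ (t + 1 + α) = γ (t + α) := fun t => by
    rw [← hγ.2.1 (t + α)]; congr 1; ring
  have hγd : ∀ t : ℝ, HasDerivAt (fun s => toComplexVec (γ (s + α)))
      (f 0 (toComplexVec (γ (t + α)))) t := fun t => (hγ.1 (t + α)).comp_add_const t α
  have hdev : deviation γ z α = fun t => toComplexVec (z t) - toComplexVec (γ (t + α)) := by
    funext t; exact toComplexVec_sub _ _
  have hfield : ∀ t, deviationField (pairedField f) Γ (rapidForcing g p n) α μ t
      (deviation γ z α t) = f μ (toComplexVec (z t)) + (((1 / (n : ℝ) : ℝ) : ℂ)) ^ p •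
        g μ ((1 / (n : ℝ) : ℝ) : ℂ) (t / (1 / (n : ℝ))) (toComplexVec (z t)) -
        f 0 (toComplexVec (γ (t + α))) := by
    intro t
    have e : Γ ((α : ℂ) + t) = toComplexVec (γ (t + α)) := by
      rw [← hΓγ]; congr 1; push_cast; ring
    rw [deviationField, add_deviation hΓγ, e]
    simp only [pairedField, rapidForcing]
    abel
  constructor
  · rintro ⟨h1, h2⟩
    refine ⟨fun t => by simp only [deviation, h1 t, hγα], fun t => ?_⟩
    rw [hfield, hdev]
    exact (h2 t).sub (hγd t)
  · rintro ⟨h1, h2⟩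
    refine ⟨fun t => ?_, fun t => ?_⟩
    · have := toComplexVec_injective (h1 t)
      rw [hγα] at this
      exact sub_left_injective this
    · have h3 := (h2 t).fun_add (hγd t)
      rw [hfield, hdev] at h3
      simp only [sub_add_cancel] at h3
      exact h3

/-- On the real line f(0, γ) = γ'. The form with f(0, Γ) is the one that continues holomorphically
to complex shifts. -/
lemma integral_section_eq_zero_iff (hγ : IsPeriodicOrbit f γ)
    (hΓγ : ∀ s : ℝ, Γ s = toComplexVec (γ s)) (α : ℝ) (z : ℝ → Fin N → ℝ) :
    ∫ s in (0 : ℝ)..1, ∑ i, (z s i - γ (s + α) i) * deriv γ (s + α) i = 0 ↔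
      ∫ s in (0 : ℝ)..1, dotCLM N (pairedField f (0, Γ ((α : ℂ) + s))) (deviation γ z α s) = 0 := by
  have e : ∀ s : ℝ, dotCLM N (pairedField f (0, Γ ((α : ℂ) + s))) (deviation γ z α s) =
      ((∑ i, (z s i - γ (s + α) i) * deriv γ (s + α) i : ℝ) : ℂ) := by
    intro s
    have : (α : ℂ) + s = ((s + α : ℝ) : ℂ) := by push_cast; ring
    rw [this, hΓγ, pairedField, hγ.field_eq, deviation, dotCLM_toComplexVec]
    rfl
  simp only [e, intervalIntegral.integral_ofReal, Complex.ofReal_eq_zero]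

/-- A locally unique real fixed point gives exactly one local solution. -/
theorem exists_unique_localSolution (hF : Differentiable ℂ (pairedField f))
    (hg : IsRealEntireForcing g) (hγ : IsPeriodicOrbit f γ)
    (hΓ : ∀ z, Γ (z + 1) = Γ z) (hΓγ : ∀ s : ℝ, Γ s = toComplexVec (γ s)) {α δ : ℝ}
    (hG : Continuous (Function.uncurry (rapidForcing g p n)))
    (hu : IsUnit (shiftedOp hF (dotCLM N) Γ α)) {v : ℂ × C(I, Fin N → ℂ)} (hvδ : ‖v‖ < δ)
    (hvs : star v = v) (hv : fixedPointOp hF (dotCLM N) Γ hG α v = v)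
    (huniq : ∀ w, ‖w‖ ≤ δ → fixedPointOp hF (dotCLM N) Γ hG α w = w → w = v) :
    ∃ z₀ : ℝ → Fin N → ℝ, ∀ μ z,
      IsLocalSolution f g p γ δ (1 / (n : ℝ)) α μ z ↔ μ = v.1.re ∧ z = z₀ := by
  have hfix := fixedPointOp_eq_self_iff (hF := hF) (B := dotCLM N) hΓ hG
    (rapidForcing_add_one hg p n) hu
  have hγp : Function.Periodic (fun t => γ (t + α)) 1 := fun t => by
    simp only []
    rw [← hγ.2.1 (t + α)]; congr 1; ring
  obtain ⟨ζ, hζ1, hζ2, hζ3, hζ4⟩ := (hfix v).1 hv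
  have hv1 : v.1 = ((v.1.re : ℝ) : ℂ) :=
    (Complex.conj_eq_iff_re.1 (congrArg Prod.fst hvs)).symm
  have hper : ∀ P : (Fin N → ℂ) → Prop, (∀ t : I, P (v.2 t)) → ∀ t, P (ζ t) := by
    intro P hP t
    have h1 := hζ1.sub_int_mul_eq (x := t) ⌊t⌋
    rw [mul_one, Int.self_sub_floor] at h1
    rw [← h1]
    have := hP ⟨Int.fract t, Int.fract_nonneg t, (Int.fract_lt_one t).le⟩
    rwa [← hζ2] at this
  have hζreal : ∀ t, IsRealVec (ζ t) := hper _ fun t =>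
    isRealVec_iff_star_eq.2 (DFunLike.congr_fun (congrArg Prod.snd hvs) t)
  have hζδ : ∀ t, ‖ζ t‖ < δ := hper (fun x => ‖x‖ < δ) fun t =>
    ((v.2.norm_coe_le_norm t).trans (norm_snd_le v)).trans_lt hvδ
  set z₀ : ℝ → Fin N → ℝ := fun t => (fun i => (ζ t i).re) + γ (t + α) with hz₀
  have hdev : deviation γ z₀ α = ζ := by
    funext t
    rw [deviation, hz₀]
    simp only [add_sub_cancel_right]
    exact (hζreal t).eq_toComplexVec.symm
  refine ⟨z₀, fun μ z => ⟨?_, ?_⟩⟩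
  · rintro ⟨hμ, hz, hsol, hsec⟩
    have h1 := (isForcedPeriodicSolution_iff hγ hΓγ α μ z).1 hsol
    have h2 := (integral_section_eq_zero_iff hγ hΓγ α z).1 hsec
    have hc : Continuous (deviation γ z α) :=
      continuous_iff_continuousAt.2 fun t => (h1.2 t).continuousAt
    -- A local solution, restricted to one period, is a fixed point in the closed δ-ball, so it must
    -- be v.
    set w : ℂ × C(I, Fin N → ℂ) := ((μ : ℂ), ⟨fun t : I => deviation γ z α t, by fun_prop⟩) with hw
    have hwv : w = v := by
      refine huniq w (norm_le_of_pair fun t => ?_) ((hfix w).2 ⟨deviation γ z α, h1.1,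
        fun t => rfl, h1.2, h2⟩)
      refine max_le ?_ ?_
      · rw [hw, Complex.norm_real]; exact hμ.le
      · change ‖deviation γ z α t‖ ≤ δ
        rw [deviation, norm_toComplexVec]
        exact (hz t).le
    refine ⟨by rw [← hwv]; simp [hw], ?_⟩
    have h3 : deviation γ z α = deviation γ z₀ α := by
      rw [hdev]
      refine h1.1.ext_unitInterval hζ1 fun t => ?_
      rw [hζ2, ← hwv]
      rfl
    funext t
    exact sub_left_injective (toComplexVec_injective (congrFun h3 t))
  · rintro ⟨rfl, rfl⟩
    refine ⟨?_, fun t => ?_, ?_, ?_⟩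
    · refine lt_of_le_of_lt ?_ hvδ
      exact (Complex.abs_re_le_norm _).trans (norm_fst_le v)
    · rw [← norm_toComplexVec]
      change ‖deviation γ z₀ α t‖ < δ
      rw [hdev]
      exact hζδ t
    · refine (isForcedPeriodicSolution_iff hγ hΓγ α _ z₀).2 ?_
      rw [hdev, ← hv1]
      exact ⟨hζ1, hζ3⟩
    · refine (integral_section_eq_zero_iff hγ hΓγ α z₀).2 ?_
      rw [hdev]
      exact hζ4

/-- Shifting a local solution by one period of the forcing gives a local solution. -/
lemma IsLocalSolution.shift (hγ : IsPeriodicOrbit f γ) (hg : IsRealEntireForcing g) (hn : 1 ≤ n)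
    {α δ μ : ℝ} {z : ℝ → Fin N → ℝ}
    (h : IsLocalSolution f g p γ δ (1 / (n : ℝ)) α μ z) :
    IsLocalSolution f g p γ δ (1 / (n : ℝ)) (α + 1 / (n : ℝ)) μ (fun s => z (s + 1 / (n : ℝ))) := by
  obtain ⟨h1, h2, ⟨h3, h4⟩, h5⟩ := h
  have hn0 : (n : ℝ) ≠ 0 := by exact_mod_cast (by omega : n ≠ 0)
  have e : ∀ s : ℝ, s + (α + 1 / (n : ℝ)) = s + 1 / (n : ℝ) + α := fun s => by ring
  refine ⟨h1, fun s => ?_, ⟨fun s => ?_, fun s => ?_⟩, ?_⟩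
  · rw [e]; exact h2 _
  · simp only []
    rw [← h3 (s + 1 / (n : ℝ))]; congr 1; ring
  · have h6 := (h4 (s + 1 / (n : ℝ))).comp_add_const s (1 / (n : ℝ))
    -- A time shift by ε advances the fast phase by exactly one period, so the equation is
    -- unchanged.
    have h7 : (s + 1 / (n : ℝ)) / (1 / (n : ℝ)) = s / (1 / (n : ℝ)) + 1 := by field_simp
    rw [h7, hg.2.2.1] at h6
    exact h6
  · let k : ℝ → ℝ := fun s => ∑ i, (z s i - γ (s + α) i) * deriv γ (s + α) i
    have hd : Function.Periodic (deriv γ) 1 := fun s => by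
      have h6 := (hγ.hasDerivAt (s + 1)).comp_add_const s 1
      have h7 : (fun x => γ (x + 1)) = γ := funext hγ.2.1
      rw [h7] at h6
      exact h6.deriv.symm
    have hk : Function.Periodic k 1 := by
      intro s
      have e1 : s + 1 + α = s + α + 1 := by ring
      simp only [k, e1, h3 s, hγ.2.1 (s + α), hd (s + α)]
    simp only [e]
    have h6 := intervalIntegral.integral_comp_add_right (a := 0) (b := 1) k (1 / (n : ℝ))
    have h7 := hk.intervalIntegral_add_eq (1 / (n : ℝ)) 0
    rw [zero_add] at h6 h7
    refine h6.trans ?_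
    rw [add_comm 1, h7]
    exact h5

end LocalSolutions

/-! ### Resonance plateaus -/

section Plateau

variable {N : ℕ} {f : ℂ → (Fin N → ℂ) → Fin N → ℂ}
  {g : ℂ → ℂ → ℝ → (Fin N → ℂ) → Fin N → ℂ} {γ : ℝ → Fin N → ℝ} {p : ℕ}

lemma stripProj_ofReal {b : ℝ} (hb : 0 ≤ b) (s : ℝ) : stripProj b (s : ℂ) = s :=
  stripProj_of_abs_im_le (by simpa using hb)

lemma comp_stripProj_add_one {Γ : C(ℂ, Fin N → ℂ)} (hΓ : ∀ z, Γ (z + 1) = Γ z) (b : ℝ) (z : ℂ) :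
    Γ.comp (stripProj b) (z + 1) = Γ.comp (stripProj b) z := by
  have := stripProj_add_ofReal b z 1
  rw [Complex.ofReal_one] at this
  rw [ContinuousMap.comp_apply, ContinuousMap.comp_apply, this, hΓ]

/-- The branch of fixed points over a closed strip of shifts. -/
theorem exists_branch_strip (hF : Differentiable ℂ (pairedField f)) (hg : IsRealEntireForcing g)
    (hp : 1 ≤ p) {Γ : C(ℂ, Fin N → ℂ)} (hΓ : ∀ z, Γ (z + 1) = Γ z) {b : ℝ} (hb : 0 ≤ b)
    (hu : ∀ α : ℂ, |α.im| ≤ b → IsUnit (shiftedOp hF (dotCLM N) Γ α)) :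
    ∃ r > 0, ∃ C : ℝ, ∀ᶠ n : ℕ in atTop, ∃ u : ℂ → ℂ × C(I, Fin N → ℂ),
      (∀ α, ‖u α‖ ≤ C / n) ∧
      (∀ α, fixedPointOp hF (dotCLM N) (Γ.comp (stripProj b)) (continuous_rapidForcing hg p n) α
        (u α) = u α) ∧
      (∀ α v, ‖v‖ ≤ r → fixedPointOp hF (dotCLM N) (Γ.comp (stripProj b))
        (continuous_rapidForcing hg p n) α v = v → v = u α) ∧ Continuous u ∧
      (∀ U, IsOpen U → (∀ t : I, DifferentiableOn ℂ
        (fun α => Γ.comp (stripProj b) (α + ((t : ℝ) : ℂ))) U) → DifferentiableOn ℂ u U) ∧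
      (∀ α S, IsClosed S → 0 ∈ S → MapsTo (fixedPointOp hF (dotCLM N) (Γ.comp (stripProj b))
        (continuous_rapidForcing hg p n) α) S S → u α ∈ S) := by
  obtain ⟨M, hM⟩ := exists_bound_inverse_shiftedOp hΓ hu
  obtain ⟨R, hR⟩ := exists_bound_of_periodic_strip (k := Γ) (b := b)
    Γ.continuous.continuousOn hΓ
  refine exists_branch (M := M) (R := R) (continuous_rapidForcing hg p)
    (differentiable_rapidForcing hg p) (fun z => hR _ (abs_stripProj_im_le hb z)) (fun α => ?_)
    (fun α => ?_) (exists_bound_rapidForcing hg hp)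
  · rw [shiftedOp_comp_stripProj]
    exact hu _ (abs_stripProj_im_le hb α)
  · rw [shiftedOp_comp_stripProj]
    exact hM _ (abs_stripProj_im_le hb α)

/-- An analytic extension of the periodic orbit to a closed strip, as a periodic curve which is
continuous on the whole plane. -/
lemma IsStripAnalytic.exists_periodic_extension (hγ : IsPeriodicOrbit f γ) {η : ℝ} (hη : 0 < η)
    (h : IsStripAnalytic γ η) : ∃ Γ : C(ℂ, Fin N → ℂ), (∀ z, Γ (z + 1) = Γ z) ∧
      (∀ s : ℝ, Γ s = toComplexVec (γ s)) ∧ DifferentiableOn ℂ Γ {z | |z.im| < η} := by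
  obtain ⟨Γ₀, hΓ₀, hΓγ⟩ := h
  set S : Set ℂ := {t : ℂ | |t.im| ≤ η} with hS
  have hSc : Convex ℝ S := by
    have : S = Complex.imLm ⁻¹' (Icc (-η) η) := by
      ext z; simp [hS, abs_le]
    rw [this]
    exact (convex_Icc _ _).linear_preimage _
  have hshift : AnalyticOnNhd ℂ (fun z => Γ₀ (z + 1)) S := fun z hz =>
    (hΓ₀ (z + 1) (by simpa [hS] using hz)).fun_comp (f := fun z => z + 1) (by fun_prop)
  have hfreq : ∃ᶠ z in 𝓝[≠] (0 : ℂ), Γ₀ (z + 1) = Γ₀ z := by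
    have ht : Tendsto (fun s : ℝ => (s : ℂ)) (𝓝[≠] 0) (𝓝[≠] 0) := by
      refine tendsto_nhdsWithin_iff.2 ⟨?_, ?_⟩
      · simpa using (Complex.continuous_ofReal.tendsto 0).mono_left nhdsWithin_le_nhds
      · filter_upwards [self_mem_nhdsWithin] with s hs
        simpa using hs
    refine ht.frequently (Frequently.of_forall fun s => ?_)
    have e : (s : ℂ) + 1 = ((s + 1 : ℝ) : ℂ) := by push_cast; rfl
    rw [e, hΓγ, hΓγ, hγ.2.1]
  -- The given extension need not be assumed periodic: the identity theorem carries the period 1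
  -- from the real line to the strip.
  have hper := hshift.eqOn_of_preconnected_of_frequently_eq hΓ₀ hSc.isPreconnected
    (show (0 : ℂ) ∈ S by simpa [hS] using hη.le) hfreq
  have hcont : Continuous fun z => Γ₀ (stripProj η z) :=
    hΓ₀.continuousOn.comp_continuous (stripProj η).continuous fun z => abs_stripProj_im_le hη.le z
  refine ⟨⟨fun z => Γ₀ (stripProj η z), hcont⟩, fun z => ?_, fun s => ?_, ?_⟩
  · have := stripProj_add_ofReal η z 1
    rw [Complex.ofReal_one] at this
    change Γ₀ (stripProj η (z + 1)) = Γ₀ (stripProj η z)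
    rw [this]
    exact hper (abs_stripProj_im_le hη.le z)
  · change Γ₀ (stripProj η s) = _
    rw [stripProj_ofReal hη.le, hΓγ]
  · refine (hΓ₀.differentiableOn.mono fun z (hz : |z.im| < η) => hz.le).congr fun z hz => ?_
    change Γ₀ (stripProj η z) = Γ₀ z
    rw [stripProj_of_abs_im_le (le_of_lt hz)]

lemma IsComplexEntire.isStripAnalytic (h : IsComplexEntire γ) (η : ℝ) : IsStripAnalytic γ η := by
  obtain ⟨Γ, hΓ, hΓγ⟩ := h
  exact ⟨Γ, fun z _ => hΓ.analyticAt z, hΓγ⟩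

/-- The identity theorem for periods: a holomorphic function on a strip which has a real period on
the real line has this period on the strip. -/
lemma periodic_strip_of_periodic_real {φ : ℂ → ℂ} {b T : ℝ} (hb : 0 < b)
    (hφ : DifferentiableOn ℂ φ {w | |w.im| < b}) (hT : ∀ s : ℝ, φ ((s + T : ℝ) : ℂ) = φ s) (w : ℂ)
    (hw : |w.im| < b) : φ (w + T) = φ w := by
  set U : Set ℂ := {w | |w.im| < b} with hU
  have hUo : IsOpen U := isOpen_lt (by fun_prop) continuous_const
  have hUc : Convex ℝ U := by
    have : U = Complex.imLm ⁻¹' (Ioo (-b) b) := by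
      ext z; simp [hU, abs_lt]
    rw [this]
    exact (convex_Ioo _ _).linear_preimage _
  have hshift : DifferentiableOn ℂ (fun z => φ (z + T)) U :=
    hφ.comp (f := fun z : ℂ => z + T) (Differentiable.differentiableOn (by fun_prop))
      fun z hz => by simpa [hU] using hz
  have hfreq : ∃ᶠ z in 𝓝[≠] (0 : ℂ), φ (z + T) = φ z := by
    have ht : Tendsto (fun s : ℝ => (s : ℂ)) (𝓝[≠] 0) (𝓝[≠] 0) := by
      refine tendsto_nhdsWithin_iff.2 ⟨?_, ?_⟩
      · simpa using (Complex.continuous_ofReal.tendsto 0).mono_left nhdsWithin_le_nhds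
      · filter_upwards [self_mem_nhdsWithin] with s hs
        simpa using hs
    refine ht.frequently (Frequently.of_forall fun s => ?_)
    have e : (s : ℂ) + T = ((s + T : ℝ) : ℂ) := by push_cast; rfl
    rw [e, hT]
  exact (hshift.analyticOnNhd hUo).eqOn_of_preconnected_of_frequently_eq (hφ.analyticOnNhd hUo)
    hUc.isPreconnected (show (0 : ℂ) ∈ U by simpa [hU] using hb) hfreq hw

theorem exists_resonance_plateau (f : ℂ → (Fin N → ℂ) → Fin N → ℂ)
    (g : ℂ → ℂ → ℝ → (Fin N → ℂ) → Fin N → ℂ) (p : ℕ) (γ : ℝ → Fin N → ℝ)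
    (hp : 1 ≤ p) (hf : IsRealEntireField f) (hg : IsRealEntireForcing g)
    (hγ : IsPeriodicOrbit f γ) (hhyp : IsHyperbolicOrbit f γ)
    (htrans : IsParameterTransverse f γ) :
    ∃ δ > 0, ∃ lam : ℕ → ℝ → ℝ,
      (∀ᶠ n : ℕ in Filter.atTop,
        (∀ α, ∃ z₀ : ℝ → Fin N → ℝ, ∀ μ z,
          IsLocalSolution f g p γ δ (1 / (n : ℝ)) α μ z ↔ μ = lam n α ∧ z = z₀) ∧
        Continuous (lam n) ∧ Function.Periodic (lam n) (1 / (n : ℝ))) ∧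
      TendstoUniformly lam (fun _ => 0) Filter.atTop ∧
      (∀ η > 0, IsStripAnalytic γ η →
        ∃ C : ℝ, ∀ᶠ n : ℕ in Filter.atTop,
          plateauWidth (lam n) ≤ C * Real.exp (-η / (1 / (n : ℝ)))) ∧
      (IsComplexEntire γ →
        ∀ η > 0, ∃ C : ℝ, ∀ᶠ n : ℕ in Filter.atTop,
          plateauWidth (lam n) ≤ C * Real.exp (-η / (1 / (n : ℝ)))) := by
  have hF : Differentiable ℂ (pairedField f) := hf.1
  -- An extension that is only continuous, constant in the imaginary direction, suffices for the
  -- branch over real shifts. Thus δ and λ are fixed before any η is chosen.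
  let Γ₀ : C(ℂ, Fin N → ℂ) := ⟨fun z => toComplexVec (γ z.re),
    continuous_toComplexVec.comp (hγ.continuous.comp Complex.continuous_re)⟩
  have hΓ₀ : ∀ z, Γ₀ (z + 1) = Γ₀ z := fun z => by
    change toComplexVec (γ (z + 1).re) = toComplexVec (γ z.re)
    rw [Complex.add_re, Complex.one_re, hγ.2.1]
  have hΓ₀γ : ∀ s : ℝ, Γ₀ s = toComplexVec (γ s) := fun s => rfl
  have hunit : ∀ α : ℂ, |α.im| ≤ 0 → IsUnit (shiftedOp hF (dotCLM N) Γ₀ α) := by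
    intro α hα
    have h1 := shiftedOp_injective_add_ofReal hΓ₀ α.re
      (shiftedOp_zero_injective hF hγ hhyp htrans hΓ₀ hΓ₀γ)
    have h2 : α = 0 + (α.re : ℂ) := by
      rw [zero_add]
      exact Complex.ext rfl (by simpa using hα)
    rw [h2]
    exact isUnit_shiftedOp_of_injective h1
  have hunit₀ : ∀ α : ℂ, IsUnit (shiftedOp hF (dotCLM N) (Γ₀.comp (stripProj 0)) α) := fun α => by
    rw [shiftedOp_comp_stripProj]
    exact hunit _ (abs_stripProj_im_le le_rfl α)
  have hreal : ∀ {Γ : C(ℂ, Fin N → ℂ)} {b : ℝ}, 0 ≤ b → (∀ s : ℝ, Γ s = toComplexVec (γ s)) →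
      ∀ s : ℝ, Γ.comp (stripProj b) s = toComplexVec (γ s) := fun hb h s => by
    rw [ContinuousMap.comp_apply, stripProj_ofReal hb, h]
  obtain ⟨δ, hδ, C, hev⟩ := exists_branch_strip hF hg hp hΓ₀ le_rfl hunit
  obtain ⟨u, hu⟩ := hev.choice
  set lam : ℕ → ℝ → ℝ := fun n α => (u n α).1.re with hlam
  have hsmall : ∀ᶠ n : ℕ in atTop, C / (n : ℝ) < δ :=
    (tendsto_const_div_atTop_nhds_zero_nat C).eventually (gt_mem_nhds hδ)
  have hstar : ∀ᶠ n : ℕ in atTop, ∀ α : ℝ, star (u n α) = u n α := by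
    filter_upwards [hu] with n hn α
    -- The real pairs form a closed invariant set containing the initial iterate 0, so the limit is
    -- real.
    refine hn.2.2.2.2.2 α {v | star v = v} (isClosed_eq continuous_star continuous_id)
      (star_zero _) (mapsTo_fixedPointOp_star hf hg (hreal le_rfl hΓ₀γ) hF _ α (hunit₀ α))
  have hmain : ∀ᶠ n : ℕ in Filter.atTop,
      (∀ α, ∃ z₀ : ℝ → Fin N → ℝ, ∀ μ z,
        IsLocalSolution f g p γ δ (1 / (n : ℝ)) α μ z ↔ μ = lam n α ∧ z = z₀) ∧
      Continuous (lam n) ∧ Function.Periodic (lam n) (1 / (n : ℝ)) := by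
    filter_upwards [hu, hsmall, hstar, eventually_ge_atTop 1] with n hn hns hnst hn1
    have h1 : ∀ α, ∃ z₀ : ℝ → Fin N → ℝ, ∀ μ z,
        IsLocalSolution f g p γ δ (1 / (n : ℝ)) α μ z ↔ μ = lam n α ∧ z = z₀ := fun α =>
      exists_unique_localSolution hF hg hγ (comp_stripProj_add_one hΓ₀ 0) (hreal le_rfl hΓ₀γ)
        (continuous_rapidForcing hg p n) (hunit₀ α) ((hn.1 α).trans_lt hns) (hnst α)
        (hn.2.1 α) (hn.2.2.1 α)
    refine ⟨h1, Complex.continuous_re.comp (continuous_fst.comp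
      (hn.2.2.2.1.comp Complex.continuous_ofReal)), fun α => ?_⟩
    obtain ⟨z₀, hz₀⟩ := h1 α
    obtain ⟨z₁, hz₁⟩ := h1 (α + 1 / (n : ℝ))
    -- The solution at α, translated by ε, is a local solution at α + ε with the same parameter;
    -- uniqueness there gives the period.
    exact ((hz₁ _ _).1 (((hz₀ _ _).2 ⟨rfl, rfl⟩).shift hγ hg hn1)).1.symm
  have hwidth : ∀ η > 0, IsStripAnalytic γ η → ∃ C : ℝ, ∀ᶠ n : ℕ in Filter.atTop,
      plateauWidth (lam n) ≤ C * Real.exp (-η / (1 / (n : ℝ))) := by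
    intro η hη hstrip
    obtain ⟨Γ, hΓ, hΓγ, hΓd⟩ := hstrip.exists_periodic_extension hγ hη
    have hη2 : 0 < η / 2 := by positivity
    -- The closed strip of half-width η/2 lies inside the open strip of half-width η on which the
    -- operators are invertible, so the inverses are uniformly bounded there.
    obtain ⟨r, hr, C', hev'⟩ := exists_branch_strip hF hg hp hΓ hη2.le fun α hα =>
      isUnit_shiftedOp_of_strip hΓ hΓd (shiftedOp_zero_injective hF hγ hhyp htrans hΓ hΓγ)
        (hα.trans_lt (by linarith))
    refine ⟨4 * C' / (1 - Real.exp (-η)), ?_⟩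
    have hsmall' : ∀ᶠ n : ℕ in atTop, C' / (n : ℝ) < δ :=
      (tendsto_const_div_atTop_nhds_zero_nat C').eventually (gt_mem_nhds hδ)
    filter_upwards [hu, hstar, hev', hsmall', hmain, eventually_ge_atTop 1]
      with n hn hnst hvex hnv hnm hn1
    obtain ⟨v, hv1, hv2, -, -, hv5, -⟩ := hvex
    -- At real shifts both branches solve the same fixed point problem, and C'/n < δ puts the strip
    -- branch into the uniqueness ball of the real one. So v continues λ holomorphically.
    have hvu : ∀ α : ℝ, v α = u n α := fun α => by
      refine hn.2.2.1 α _ ((hv1 α).trans hnv.le) ?_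
      rw [fixedPointOp_congr (Γ₁ := Γ₀.comp (stripProj 0)) (Γ₂ := Γ.comp (stripProj (η / 2)))]
      · exact hv2 α
      · intro t
        rw [← Complex.ofReal_add, hreal le_rfl hΓ₀γ, hreal hη2.le hΓγ]
    have hvlam : ∀ α : ℝ, (v α).1 = lam n α := fun α => by
      rw [hvu]
      exact (Complex.conj_eq_iff_re.1 (congrArg Prod.fst (hnst α))).symm
    have hd : DifferentiableOn ℂ (fun α => (v α).1) {w | |w.im| < η / 2} := by
      refine (hv5 _ (isOpen_lt (by fun_prop) continuous_const) fun t => ?_).fst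
      have hΓt : DifferentiableOn ℂ (fun α => Γ (α + ((t : ℝ) : ℂ))) {w | |w.im| < η / 2} :=
        hΓd.comp (f := fun α : ℂ => α + ((t : ℝ) : ℂ))
          (Differentiable.differentiableOn (by fun_prop)) fun z (hz : |z.im| < η / 2) => by
            have : |z.im| < η := by linarith
            simpa using this
      refine hΓt.congr fun z (hz : |z.im| < η / 2) => ?_
      rw [ContinuousMap.comp_apply, stripProj_of_abs_im_le (by simpa using hz.le)]
    have hC' : 0 ≤ C' / n := (norm_nonneg _).trans (hv1 0)
    have hn0 : (0 : ℝ) < n := by exact_mod_cast hn1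
    -- The bound on the strip must not depend on n, so that it can enter the constant of the
    -- exponential estimate.
    have hCC : C' / n ≤ C' := by
      have h0 : 0 ≤ C' := by
        have := mul_nonneg hC' hn0.le
        rwa [div_mul_cancel₀ _ hn0.ne'] at this
      exact div_le_self h0 (by exact_mod_cast hn1)
    have hosc := norm_sub_le_exp_of_periodic_strip (φ := fun α => (v α).1) (r := C') hη hn1 hd
      (fun w hw => by
        have h1 := periodic_strip_of_periodic_real (T := 1 / (n : ℝ)) hη2 hd
          (fun s => by simp only [hvlam, hnm.2.2 s]) w hw
        push_cast at h1
        exact h1)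
      (fun w _ => ((norm_fst_le (v w)).trans (hv1 w)).trans hCC)
    have hb : 0 ≤ 4 * C' / (1 - Real.exp (-η)) * Real.exp (-η / (1 / (n : ℝ))) :=
      (norm_nonneg _).trans (hosc 0 0)
    refine Metric.diam_le_of_forall_dist_le hb ?_
    rintro _ ⟨x, rfl⟩ _ ⟨y, rfl⟩
    have := hosc x y
    rw [hvlam, hvlam, ← Complex.ofReal_sub, Complex.norm_real] at this
    exact this
  refine ⟨δ, hδ, lam, hmain, ?_, hwidth, fun h η hη => hwidth η hη (h.isStripAnalytic η)⟩
  rw [Metric.tendstoUniformly_iff]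
  intro κ hκ
  filter_upwards [hu, (tendsto_const_div_atTop_nhds_zero_nat C).eventually (gt_mem_nhds hκ)]
    with n hn hnκ α
  rw [dist_zero_left, Real.norm_eq_abs]
  exact ((Complex.abs_re_le_norm _).trans ((norm_fst_le _).trans (hn.1 α))).trans_lt hnκ

end Plateau

end

/-- There is a locally unique branch `lam n α = λ(1/n, α)` of parameters of 1-periodic solutions
near the orbit `γ(· + α)`; it is continuous and of period `1/n` in `α` and tends to 0 uniformly
in `α`. The width of the plateau `I(1/n) = λ(1/n, ℝ)` is exponentially small on analyticity strips,
and ultra-exponentially small for entire `γ`. -/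
theorem theorem7p1 {N : ℕ} (f : ℂ → (Fin N → ℂ) → Fin N → ℂ)
    (g : ℂ → ℂ → ℝ → (Fin N → ℂ) → Fin N → ℂ) (p : ℕ) (γ : ℝ → Fin N → ℝ)
    (hp : 1 ≤ p) (hf : IsRealEntireField f) (hg : IsRealEntireForcing g)
    (hγ : IsPeriodicOrbit f γ) (hhyp : IsHyperbolicOrbit f γ)
    (htrans : IsParameterTransverse f γ) :
    ∃ δ > 0, ∃ lam : ℕ → ℝ → ℝ,
      (∀ᶠ n : ℕ in Filter.atTop,
        (∀ α, ∃ z₀ : ℝ → Fin N → ℝ, ∀ μ z,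
          IsLocalSolution f g p γ δ (1 / (n : ℝ)) α μ z ↔ μ = lam n α ∧ z = z₀) ∧
        Continuous (lam n) ∧ Function.Periodic (lam n) (1 / (n : ℝ))) ∧
      TendstoUniformly lam (fun _ => 0) Filter.atTop ∧
      (∀ η > 0, IsStripAnalytic γ η →
        ∃ C : ℝ, ∀ᶠ n : ℕ in Filter.atTop,
          plateauWidth (lam n) ≤ C * Real.exp (-η / (1 / (n : ℝ)))) ∧
      (IsComplexEntire γ →
        ∀ η > 0, ∃ C : ℝ, ∀ᶠ n : ℕ in Filter.atTop,
          plateauWidth (lam n) ≤ C * Real.exp (-η / (1 / (n : ℝ)))) := by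
  exact exists_resonance_plateau f g p γ hp hf hg hγ hhyp htrans
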